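/- For a finite subset $\Sigma$ of a group $G$ let $\tilde\Sigma=\Sigma\cup\Sigma^{-1}$, and for a word $w\in\tilde\Sigma^*$ of length $|w|$ let $\mathsf M(w)\in G$ be its value. The Word Problem $\mathsf{WP}_\Sigma$ asks, given $w\in\tilde\Sigma^*$, whether $\mathsf M(w)=1$. It is solvable with worst-case (bit) complexity $O(n)$ if there are a deterministic Turing machine with finitely many stacks over finite alphabets (equivalently, up to a constant factor in time, a multitape Turing machine), which receives $w$ as a string of $|w|$ letters of $\tilde\Sigma$, and a function $t(n)=O(n)$, such that on every $w\in\tilde\Sigma^*$ the machine halts after at most $t(|w|)$ steps and answers correctly whether $\mathsf M(w)=1$. Here $G$ and $\Sigma$ are fixed: the machine, $t$ and the constants may depend on them. **(1)** Let $d\ge 0$ and let $\Sigma\subset \mathsf{GL}_d(\mathbb Z)$ be finite. If all matrices in $\Sigma$ are upper triangular, or all are lower triangular, then $\mathsf{WP}_\Sigma$ is solvable with worst-case bit complexity $O(n)$. Moreover, the entries of $\mathsf M(w)$ grow only polynomially: there is a constant $C$ such that $|\mathsf M(w)_{i,j}|\le C\,(|w|+1)^{|j-i|}$ for all $w\in\tilde\Sigma^*$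 and all $1\le i,j\le d$. **(2)** Let $G$ be a finitely generated torsion-free nilpotent group. Then for every finite subset $\Sigma$ of $G$ (in particular for every finite generating set) the Word Problem of $G$ relative to $\Sigma$ is solvable in linear worst-case time $O(n)$. -/

import Mathlib

/-- The symmetrized alphabet `S ∪ S⁻¹` of a subset `S` of a group. -/
def symAlphabet {G : Type*} [Group G] (S : Set G) : Set G :=
  {x | x ∈ S ∨ x⁻¹ ∈ S}

/-- The value in `G` of a word over the alphabet `S ∪ S⁻¹`. -/
def wordValue {G : Type*} [Group G] {S : Set G} (w : List (symAlphabet S)) : G :=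
  (w.map Subtype.val).prod

open Classical in
/-- The Turing machine `tm` (a deterministic machine with finitely many stacks, one of which initially
holds the input word, one letter of `S ∪ S⁻¹` per cell, the leftmost letter on top) decides the
Word Problem relative to `S`, and on every input word `w` it halts after at most `t |w|` steps.
The equivalences `inp` and `out` only name the symbols of the input and output stacks. -/
def SolvesWordProblemInTime {G : Type*} [Group G] (S : Set G) (tm : Turing.FinTM2)
    (inp : symAlphabet S ≃ tm.Γ tm.k₀) (out : Bool ≃ tm.Γ tm.k₁) (t : ℕ → ℕ) : Prop :=
  ∀ w : List (symAlphabet S),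
    Nonempty (Turing.TM2OutputsInTime tm (w.map inp)
      (some [out (decide (wordValue w = 1))]) (t w.length))

/-- The Word Problem relative to `S` is solvable with worst-case bit complexity `O(n)`, where `n`
is the length of the input word: some single Turing machine, with finite alphabets on all of its
stacks, decides it within a number of elementary steps that is `O(n)`. -/
def WordProblemLinearTime {G : Type*} [Group G] (S : Set G) : Prop :=
  ∃ (tm : Turing.FinTM2) (inp : symAlphabet S ≃ tm.Γ tm.k₀) (out : Bool ≃ tm.Γ tm.k₁)
    (t : ℕ → ℕ),
    (∀ k, Finite (tm.Γ k)) ∧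
    SolvesWordProblemInTime S tm inp out t ∧
    (fun n => (t n : ℝ)) =O[Filter.atTop] (fun n => (n : ℝ))

/-! Let `U` be the group of invertible integral upper triangular `d × d` matrices. The dilation `δ`,
which multiplies the `k`-th superdiagonal by `3 ^ k`, is an injective endomorphism of `U` whose
image has finite index. Measure a matrix by the least `s` for which its entries are bounded by those
of `exp (s N)`, where `N` is the full Jordan block. This size is subadditive, only finitely many
matrices have size at most `s`, and `δ` triples size. Hence, for a suitable finite ball `E` in `U`
and finitely many coset representatives `r`, every product `y * x * r` with `x`, `y` in `E` equals
`r' * δ e` with `e` again in `E`. Reading a word from right to left with `r` as carry rewrites it as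
`r * δ w'`, where `w'` has half as many letters. The word is trivial iff `r` is trivial and `w'` has
value `1`. Iterating costs `n + n/2 + n/4 + ⋯ = O(n)` steps. Subadditivity of the size also gives
the polynomial growth of entries.

A finitely generated torsion-free nilpotent group `G` is reduced to this case by embedding it in
some `U`. With `I` the augmentation ideal of `ℚG`, the group acts unitriangularly on the
finite-dimensional space `ℚG / I ^ m`. The action is faithful if `I ^ m` contains no `z - 1` with `z
≠ 1`. Such an `m` is found by climbing a chain of isolated normal subgroups with infinite cyclic
steps (`exists_forall_notMem_aug_pow`). A dilation by a common denominator then makes the matrices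
integral. -/

/-! ### A stack machine that repeatedly halves a word -/

namespace WordHalving

/-- The finite data of a transducer that reads a word over `E` from right to left, two letters at a
time, keeping a carry in `R` and emitting one letter of `E` for each pair. -/
structure Transducer (α E R : Type) where
  /-- the translation of input letters -/
  conv : α → E
  /-- the neutral letter -/
  one : E
  /-- the neutral carry -/
  carry₀ : R
  /-- the result of reading two letters with a given carry -/
  step : E → E → R → R × E

/-- The contents of the halving machine. -/
inductive Stack
  | inp | out | fwd | bwd
  deriving DecidableEq

instance : Fintype Stack :=
  ⟨{.inp, .out, .fwd, .bwd}, fun k => by cases k <;> simp⟩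

/-- The labels of the halving machine. -/
inductive Label
  | read | start | pass | copy
  deriving DecidableEq

instance : Fintype Label :=
  ⟨{.read, .start, .pass, .copy}, fun k => by cases k <;> simp⟩

/-- The alphabets of the stacks. -/
abbrev Alphabet (α E : Type) : Stack → Type
  | .inp => α
  | .out => Bool
  | .fwd => E
  | .bwd => E

variable {α E R : Type}

/-- The internal state: the conjunction of the tests made so far, the carry, and two letters. -/
abbrev State (E R : Type) : Type := Bool × R × Option E × Option E

namespace Transducer

open Classical in
/-- The program of the halving machine. -/
noncomputable def program (T : Transducer α E R) :
    Label → Turing.TM2.Stmt (Alphabet α E) Label (State E R)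
  | .read =>
    .pop .inp (fun s a => (s.1, s.2.1, a.map T.conv, none)) <|
    .branch (fun s => s.2.2.1.isSome)
      (.push .fwd (fun s => s.2.2.1.getD T.one) <|
        .load (fun s => (s.1, s.2.1, none, none)) <| .goto fun _ => .read)
      (.goto fun _ => .start)
  | .start =>
    .pop .fwd (fun s a => (s.1, s.2.1, a, none)) <|
    .pop .fwd (fun s a => (s.1, s.2.1, s.2.2.1, a)) <|
    -- A pass would not shorten a word of at most one letter, so such a word is tested directly;
    -- `getD` reads the empty word as the neutral letter. The top of `fwd` is the right end of the
    -- word, so the second letter popped is the left factor.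
    .branch (fun s => s.2.2.2.isSome)
      (.push .bwd (fun s => (T.step (s.2.2.2.getD T.one) (s.2.2.1.getD T.one) s.2.1).2) <|
        .load (fun s => (s.1, (T.step (s.2.2.2.getD T.one) (s.2.2.1.getD T.one) s.2.1).1,
          none, none)) <| .goto fun _ => .pass)
      (.push .out (fun s => s.1 && decide (s.2.2.1.getD T.one = T.one)) <|
        .load (fun _ => (true, T.carry₀, none, none)) .halt)
  | .pass =>
    .pop .fwd (fun s a => (s.1, s.2.1, a, none)) <|
    .branch (fun s => s.2.2.1.isSome)
      (.pop .fwd (fun s a => (s.1, s.2.1, s.2.2.1, a)) <|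
        -- When the length is odd, `getD` pads the last letter with the neutral letter on its left.
        .push .bwd (fun s => (T.step (s.2.2.2.getD T.one) (s.2.2.1.getD T.one) s.2.1).2) <|
        .load (fun s => (s.1, (T.step (s.2.2.2.getD T.one) (s.2.2.1.getD T.one) s.2.1).1,
          none, none)) <| .goto fun _ => .pass)
      (.load (fun s => (s.1 && decide (s.2.1 = T.carry₀), T.carry₀, none, none)) <|
        .goto fun _ => .copy)
  | .copy =>
    .pop .bwd (fun s a => (s.1, s.2.1, a, none)) <|
    .branch (fun s => s.2.2.1.isSome)
      (.push .fwd (fun s => s.2.2.1.getD T.one) <|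
        .load (fun s => (s.1, s.2.1, none, none)) <| .goto fun _ => .copy)
      (.goto fun _ => .start)

/-- The halving machine. -/
noncomputable def machine [Fintype α] [Fintype E] [Fintype R] (T : Transducer α E R) :
    Turing.FinTM2 where
  K := Stack
  k₀ := .inp
  k₁ := .out
  Γ := Alphabet α E
  Λ := Label
  main := .read
  σ := State E R
  initialState := (true, T.carry₀, none, none)
  Γk₀Fin := inferInstanceAs (Fintype α)
  m := T.program

/-- The contents of the stacks. -/
def contents (i : List α) (o : List Bool) (f b : List E) : ∀ k, List (Alphabet α E k)
  | .inp => i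
  | .out => o
  | .fwd => f
  | .bwd => b

lemma update_inp (i i' : List α) (o : List Bool) (f b : List E) :
    Function.update (contents i o f b) .inp i' = contents i' o f b := by
  funext k; cases k <;> simp [contents]

lemma update_out (i : List α) (o o' : List Bool) (f b : List E) :
    Function.update (contents i o f b) .out o' = contents i o' f b := by
  funext k; cases k <;> simp [contents]

lemma update_fwd (i : List α) (o : List Bool) (f f' b : List E) :
    Function.update (contents i o f b) .fwd f' = contents i o f' b := by
  funext k; cases k <;> simp [contents]

lemma update_bwd (i : List α) (o : List Bool) (f b b' : List E) :
    Function.update (contents i o f b) .bwd b' = contents i o f b' := by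
  funext k; cases k <;> simp [contents]

/-- The machine reaches the configuration `c'` from `c` in at most `m` steps. -/
def ReachesIn (T : Transducer α E R) (c c' : Turing.TM2.Cfg (Alphabet α E) Label (State E R))
    (m : ℕ) : Prop :=
  Nonempty (StateTransition.EvalsToInTime (Turing.TM2.step T.program) c (some c') m)

lemma ReachesIn.head {T : Transducer α E R}
    {c c₁ c' : Turing.TM2.Cfg (Alphabet α E) Label (State E R)} {m : ℕ}
    (h : Turing.TM2.step T.program c = some c₁) : T.ReachesIn c₁ c' m → T.ReachesIn c c' (m + 1) :=
  fun ⟨h'⟩ => ⟨StateTransition.EvalsToInTime.trans _ 1 m c c₁ _ ⟨⟨1, h⟩, le_rfl⟩ h'⟩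

lemma ReachesIn.mono {T : Transducer α E R}
    {c c' : Turing.TM2.Cfg (Alphabet α E) Label (State E R)} {m n : ℕ} (hmn : m ≤ n) :
    T.ReachesIn c c' m → T.ReachesIn c c' n :=
  fun ⟨h⟩ => ⟨⟨h.toEvalsTo, h.steps_le_m.trans hmn⟩⟩

/-- A configuration between two passes or inside one. -/
def config (l : Label) (t : Bool) (r : R) (i : List α) (f b : List E) :
    Turing.TM2.Cfg (Alphabet α E) Label (State E R) :=
  ⟨some l, (t, r, none, none), contents i [] f b⟩

/-- The halting configuration with a given answer. -/
def answer (T : Transducer α E R) (t : Bool) :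
    Turing.TM2.Cfg (Alphabet α E) Label (State E R) :=
  ⟨none, (true, T.carry₀, none, none), contents [] [t] [] []⟩

/-- Reading a word (given from right to left) in pairs, on top of letters already emitted. -/
def run (T : Transducer α E R) : R → List E → List E → R × List E
  | r, [], b => (r, b)
  | r, [x], b => ((T.step T.one x r).1, (T.step T.one x r).2 :: b)
  | r, x :: y :: l, b => T.run (T.step y x r).1 l ((T.step y x r).2 :: b)

lemma length_run (T : Transducer α E R) (r : R) (l b : List E) :
    (T.run r l b).2.length = (l.length + 1) / 2 + b.length := by
  fun_induction run T r l b with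
  | case1 => simp
  | case2 => simp; omega
  | case3 r x y l b ih => rw [ih]; simp; omega

variable {T : Transducer α E R} {c : Turing.TM2.Cfg (Alphabet α E) Label (State E R)} {m : ℕ}

lemma reachesIn_read {t : Bool} {r : R} {i : List α} {f : List E}
    (h : T.ReachesIn (config .start t r [] ((i.map T.conv).reverse ++ f) []) c m) :
    T.ReachesIn (config .read t r i f []) c (m + i.length + 1) := by
  induction i generalizing f with
  | nil => exact .head (by simp [config, program, contents, update_inp]) h
  | cons a i ih =>
    refine .head (c₁ := config .read t r i (T.conv a :: f) [])
      (by simp [config, program, contents, update_inp, update_fwd]) ?_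
    exact ih (by simpa using h)

lemma reachesIn_copy {t : Bool} {r : R} {b f : List E}
    (h : T.ReachesIn (config .start t r [] (b.reverse ++ f) []) c m) :
    T.ReachesIn (config .copy t r [] f b) c (m + b.length + 1) := by
  induction b generalizing f with
  | nil => exact .head (by simp [config, program, contents, update_bwd]) h
  | cons a b ih =>
    refine .head (c₁ := config .copy t r [] (a :: f) b)
      (by simp [config, program, contents, update_bwd, update_fwd]) ?_
    exact ih (by simpa using h)

open Classical in
lemma reachesIn_pass {t : Bool} {r : R} {f b : List E}
    (h : T.ReachesIn (config .copy (t && decide ((T.run r f b).1 = T.carry₀)) T.carry₀ [] []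
      (T.run r f b).2) c m) :
    T.ReachesIn (config .pass t r [] f b) c (m + f.length + 1) := by
  fun_induction run T r f b with
  | case1 => exact .head (by simp [config, program, contents, update_fwd]) h
  | case2 r x b =>
    refine .head (c₁ := config .pass t (T.step T.one x r).1 [] []
      ((T.step T.one x r).2 :: b))
      (by simp [config, program, contents, update_fwd, update_bwd]) ?_
    exact .head (by simp [config, program, contents, update_fwd]) h
  | case3 r x y l b ih =>
    refine .mono (m := m + l.length + 1 + 1) (by simp) (.head ?_ (ih h))
    simp [config, program, contents, update_fwd, update_bwd]

-- A pass over `n ≥ 2` letters takes `O(n)` steps and leaves `⌈n / 2⌉ < n` letters, so the total is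
-- bounded by a geometric sum. `P` stands for "the word has value `1`"; only its compatibility with
-- passes is needed.
open Classical in
lemma reachesIn_answer {t : Bool} (f : List E) (P : List E → Prop) (hnil : P [])
    (hone : ∀ x, P [x] ↔ x = T.one)
    (hrun : ∀ f, P f ↔ (T.run T.carry₀ f []).1 = T.carry₀ ∧ P (T.run T.carry₀ f []).2.reverse) :
    T.ReachesIn (config .start t T.carry₀ [] f []) (T.answer (t && decide (P f)))
      (10 * f.length + 1) := by
  induction hn : f.length using Nat.strong_induction_on generalizing f t with
  | _ n ih =>
    match f with
    | [] =>
      refine .mono (m := 0 + 1) (by omega)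
        (.head ?_ ⟨StateTransition.EvalsToInTime.refl _ _⟩)
      simp [config, answer, program, contents, update_fwd, update_out, hnil]
    | [x] =>
      refine .mono (m := 0 + 1) (by omega)
        (.head ?_ ⟨StateTransition.EvalsToInTime.refl _ _⟩)
      simp [config, answer, program, contents, update_fwd, update_out, hone]
    | x :: y :: l =>
      have hlen := T.length_run T.carry₀ (x :: y :: l) []
      simp only [List.length_cons, List.length_nil] at hlen hn
      have h1 := ih (T.run T.carry₀ (x :: y :: l) []).2.reverse.length
        (by rw [List.length_reverse]; omega)
        (t := t && decide ((T.run T.carry₀ (x :: y :: l) []).1 = T.carry₀)) _ rfl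
      have hP : (t && decide (P (x :: y :: l))) =
          ((t && decide ((T.run T.carry₀ (x :: y :: l) []).1 = T.carry₀)) &&
            decide (P (T.run T.carry₀ (x :: y :: l) []).2.reverse)) := by
        rw [Bool.and_assoc, ← Bool.decide_and, decide_eq_decide.2 (hrun (x :: y :: l))]
      rw [hP]
      have h2 := reachesIn_pass (r := (T.step y x T.carry₀).1) (f := l)
        (b := [(T.step y x T.carry₀).2])
        (reachesIn_copy (f := []) (by rw [List.append_nil]; exact h1))
      refine .mono ?_ (.head ?_ h2)
      · rw [List.length_reverse, ← hn, hlen,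
          show (T.run (T.step y x T.carry₀).1 l [(T.step y x T.carry₀).2]).2.length = _ from hlen]
        omega
      · simp [config, program, contents, update_fwd, update_bwd]

open Classical in
lemma outputs_machine [Fintype α] [Fintype E] [Fintype R] (T : Transducer α E R)
    (P : List E → Prop) (hnil : P []) (hone : ∀ x, P [x] ↔ x = T.one)
    (hrun : ∀ f, P f ↔ (T.run T.carry₀ f []).1 = T.carry₀ ∧ P (T.run T.carry₀ f []).2.reverse)
    (w : List α) :
    Nonempty (Turing.TM2OutputsInTime T.machine w (some [decide (P (w.map T.conv).reverse)])
      (11 * w.length + 2)) := by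
  have h := reachesIn_answer (T := T) (t := true) (w.map T.conv).reverse P hnil hone hrun
  have h' := (reachesIn_read (f := []) (i := w) (by simpa using h)).mono
    (n := 11 * w.length + 2) (by simp; omega)
  have e1 : Turing.initList T.machine w = config .read true T.carry₀ w [] [] := by
    simp only [Turing.initList, config, machine]
    congr 1
    funext k
    cases k <;> rfl
  have e2 : ∀ t, Turing.haltList T.machine [t] = T.answer t := by
    intro t
    simp only [Turing.haltList, answer, machine]
    congr 1
    funext k
    cases k <;> rfl
  change Nonempty (StateTransition.EvalsToInTime T.machine.step (Turing.initList T.machine w)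
    (some (Turing.haltList T.machine [_])) _)
  rw [e1, e2 (decide _)]
  exact h'

/-- The evaluation of a word in a monoid commutes with a pass of the transducer, up to the
endomorphism `δ`. -/
lemma prod_run {M : Type*} [Monoid M] (δ : M →* M) (T : Transducer α E R) (vE : E → M) (vR : R → M)
    (hone : vE T.one = 1)
    (hstep : ∀ y x r, vE y * vE x * vR r = vR (T.step y x r).1 * δ (vE (T.step y x r).2))
    (r : R) (f b : List E) :
    (f.reverse.map vE).prod * vR r * δ (b.map vE).prod =
      vR (T.run r f b).1 * δ ((T.run r f b).2.map vE).prod := by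
  fun_induction run T r f b with
  | case1 => simp
  | case2 r x b =>
    have := hstep T.one x r
    rw [hone, one_mul] at this
    simp [this, mul_assoc]
  | case3 r x y l b ih =>
    rw [← ih]
    have := hstep y x r
    simp only [List.reverse_cons, List.map_append, List.map_cons, List.map_nil, List.prod_append,
      List.prod_cons, List.prod_nil, mul_one, map_mul, mul_assoc] at this ⊢
    rw [← mul_assoc (vR _), ← this]
    simp only [mul_assoc]

end Transducer

end WordHalving

lemma symAlphabet_finite {G : Type*} [Group G] {S : Set G} (hS : S.Finite) :
    Finite (symAlphabet S) := by
  refine Set.Finite.to_subtype ((hS.union hS.inv).subset ?_)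
  rintro x (hx | hx)
  · exact .inl hx
  · exact .inr (by simpa using hx)

open WordHalving in
/-- A finite symmetric alphabet that is evaluated in a monoid with a contracting endomorphism
`δ` has a word problem that is solvable in linear time. -/
theorem wordProblemLinearTime_of_halving {G : Type*} [Group G] {S : Set G} (hS : S.Finite)
    {M : Type*} [Monoid M] (δ : M →* M) {E R : Type} [Finite E] [Finite R]
    (vE : E → M) (vR : R → M) (hE : Function.Injective vE) (one : E) (hone : vE one = 1)
    (carry₀ : R) (hcarry₀ : vR carry₀ = 1)
    (hstep : ∀ y x r, ∃ p : R × E, vE y * vE x * vR r = vR p.1 * δ (vE p.2))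
    (hδ : ∀ r g, vR r * δ g = 1 → r = carry₀ ∧ g = 1)
    (conv : symAlphabet S → E)
    (hconv : ∀ w : List (symAlphabet S),
      wordValue w = 1 ↔ (w.map fun a => vE (conv a)).prod = 1) :
    WordProblemLinearTime S := by
  classical
  have := symAlphabet_finite hS
  cases nonempty_fintype E
  cases nonempty_fintype R
  -- The alphabets of the machine must live in `Type`, while `G` may be in any universe; letters are
  -- therefore replaced by indices.
  have e := Finite.equivFin (symAlphabet S)
  choose step hstep using hstep
  let T : Transducer (Fin (Nat.card (symAlphabet S))) E R := ⟨conv ∘ e.symm, one, carry₀, step⟩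
  -- The stack `fwd` lists a word from right to left, hence the reversal.
  let P : List E → Prop := fun f => (f.reverse.map vE).prod = 1
  have hrun : ∀ f, P f ↔ (T.run T.carry₀ f []).1 = T.carry₀ ∧
      P (T.run T.carry₀ f []).2.reverse := by
    intro f
    have := T.prod_run δ vE vR hone hstep carry₀ f []
    simp only [hcarry₀, mul_one, List.map_nil, List.prod_nil, map_one] at this
    simp only [P, this, List.reverse_reverse]
    refine ⟨hδ _ _, ?_⟩
    rintro ⟨h1, h2⟩
    rw [h2, show (T.run carry₀ f []).1 = carry₀ from h1, hcarry₀, map_one, mul_one]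
  refine ⟨T.machine, e, Equiv.refl Bool, fun n => 11 * n + 2, ?_, ?_, ?_⟩
  · rintro (_ | _ | _ | _)
    · exact inferInstanceAs (Finite (Fin _))
    · exact inferInstanceAs (Finite Bool)
    · exact inferInstanceAs (Finite E)
    · exact inferInstanceAs (Finite E)
  · intro w
    have h := T.outputs_machine P (by simp [P])
      (by intro x; simp only [P, List.reverse_singleton, List.map_singleton, List.prod_singleton,
            ← hone, hE.eq_iff]; rfl) hrun (w.map e)
    have hP : P ((w.map e).map T.conv).reverse ↔ wordValue w = 1 := by
      have : (w.map e).map T.conv = w.map conv := by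
        rw [List.map_map]
        exact List.map_congr_left fun a _ => congrArg conv (e.symm_apply_apply a)
      simp only [P, this, List.reverse_reverse, List.map_map, hconv]
      rfl
    simp only [hP, List.length_map] at h
    exact h
  · refine Asymptotics.IsBigO.of_bound 13 ?_
    filter_upwards [Filter.eventually_ge_atTop 1] with n hn
    have : (1 : ℝ) ≤ n := by exact_mod_cast hn
    simp only [Nat.cast_add, Nat.cast_mul, Nat.cast_ofNat, Real.norm_eq_abs]
    rw [abs_of_nonneg (by positivity), abs_of_nonneg (by positivity)]
    linarith

/-! ### Integral upper triangular matrices -/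

/-- The monoid of upper triangular matrices. -/
def upperTriangular (d : ℕ) (R : Type*) [CommRing R] : Submonoid (Matrix (Fin d) (Fin d) R) where
  carrier := {A | A.IsUpperTriangular}
  mul_mem' := Matrix.BlockTriangular.mul
  one_mem' := Matrix.blockTriangular_one

namespace upperTriangular

open Matrix Finset
open scoped Nat

variable {d : ℕ} {R : Type*} [CommRing R]

lemma mul_apply_eq_sum_Icc {A B : Matrix (Fin d) (Fin d) R} (hA : A.IsUpperTriangular)
    (hB : B.IsUpperTriangular) (i j : Fin d) :
    (A * B) i j = ∑ k ∈ Icc i j, A i k * B k j := by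
  rw [Matrix.mul_apply]
  refine (sum_subset (subset_univ _) fun k _ hk => ?_).symm
  rw [mem_Icc, not_and_or, not_le, not_le] at hk
  rcases hk with hk | hk
  · rw [hA (show id k < id i from hk), zero_mul]
  · rw [hB (show id j < id k from hk), mul_zero]

/-- The dilation that multiplies the `k`-th upper diagonal by `q ^ k`. -/
def dilation (d : ℕ) (q : R) : upperTriangular d R →* upperTriangular d R where
  toFun A := ⟨.of fun i j => q ^ ((j : ℕ) - i) * A.1 i j, fun i j hij => by
    simp [A.2 hij]⟩
  map_one' := by
    ext i j
    by_cases h : i = j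
    · subst h; simp
    · simp [Matrix.one_apply_ne h]
  map_mul' A B := by
    ext i j
    have hA : (Matrix.of fun i j : Fin d => q ^ ((j : ℕ) - i) * A.1 i j).IsUpperTriangular :=
      fun i j hij => by simp [A.2 hij]
    have hB : (Matrix.of fun i j : Fin d => q ^ ((j : ℕ) - i) * B.1 i j).IsUpperTriangular :=
      fun i j hij => by simp [B.2 hij]
    change q ^ ((j : ℕ) - i) * (A.1 * B.1) i j =
      ((Matrix.of fun i j : Fin d => q ^ ((j : ℕ) - i) * A.1 i j) *
        Matrix.of fun i j : Fin d => q ^ ((j : ℕ) - i) * B.1 i j : Matrix (Fin d) (Fin d) R) i j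
    -- Only `i ≤ k ≤ j` contributes, and there the truncated exponents `k - i` and `j - k` add up to
    -- `j - i`.
    rw [mul_apply_eq_sum_Icc hA hB, mul_apply_eq_sum_Icc A.2 B.2, mul_sum]
    refine sum_congr rfl fun k hk => ?_
    rw [mem_Icc, Fin.le_def, Fin.le_def] at hk
    rw [of_apply, of_apply, show (j : ℕ) - i = (k - i) + (j - k) by omega, pow_add]
    ring

@[simp]
lemma dilation_apply (q : R) (A : upperTriangular d R) (i j : Fin d) :
    (dilation d q A).1 i j = q ^ ((j : ℕ) - i) * A.1 i j := rfl

lemma dilation_injective [IsDomain R] {q : R} (hq : q ≠ 0) :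
    Function.Injective (dilation d q) := by
  intro A B h
  ext i j
  have := congrArg (fun M : upperTriangular d R => M.1 i j) h
  simpa [hq] using this

lemma exists_dilation_eq {q : R} (A : upperTriangular d R)
    (h : ∀ i j : Fin d, i < j → q ^ ((j : ℕ) - i) ∣ A.1 i j) : ∃ B, dilation d q B = A := by
  have h' : ∀ i j : Fin d, ∃ b, A.1 i j = q ^ ((j : ℕ) - i) * b := by
    intro i j
    by_cases hij : i < j
    · exact h i j hij
    · exact ⟨A.1 i j, by rw [Nat.sub_eq_zero_of_le (not_lt.1 hij), pow_zero, one_mul]⟩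
  choose B hB using h'
  have hu : (Matrix.of fun i j : Fin d => if j < i then 0 else B i j).IsUpperTriangular :=
    fun i j hij => if_pos hij
  refine ⟨⟨_, hu⟩, ?_⟩
  ext i j
  rw [dilation_apply]
  change _ * (if j < i then 0 else B i j) = _
  split_ifs with hij
  · rw [mul_zero, A.2 hij]
  · exact (hB i j).symm

/-! ### The size of an integral triangular matrix -/

/-- The size of an upper triangular integral matrix is at most `s` if its entries are bounded by
those of the exponential of `s` times the full nilpotent Jordan block. -/
def SizeLE (s : ℕ) (A : Matrix (Fin d) (Fin d) ℤ) : Prop :=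
  ∀ i j : Fin d, i ≤ j → ((j - i : ℕ)! : ℤ) * |A i j| ≤ (s : ℤ) ^ (j - i : ℕ)

lemma SizeLE.mono {s t : ℕ} (h : s ≤ t) {A : Matrix (Fin d) (Fin d) ℤ} (hA : SizeLE s A) :
    SizeLE t A := fun i j hij => (hA i j hij).trans (by gcongr)

lemma sizeLE_one : SizeLE 0 (1 : Matrix (Fin d) (Fin d) ℤ) := by
  intro i j hij
  rcases hij.eq_or_lt with rfl | h
  · simp
  · simp [Matrix.one_apply_ne h.ne]

/-- This is `exp (s N) * exp (t N) = exp ((s + t) N)` for the nilpotent Jordan block `N`, which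
entrywise is the binomial theorem. -/
lemma SizeLE.mul {s t : ℕ} {A B : Matrix (Fin d) (Fin d) ℤ} (hA : A.IsUpperTriangular)
    (hB : B.IsUpperTriangular) (hs : SizeLE s A) (ht : SizeLE t B) : SizeLE (s + t) (A * B) := by
  intro i j hij
  rw [mul_apply_eq_sum_Icc hA hB]
  have key : ∀ k ∈ Icc i j, (((j : ℕ) - i)! : ℤ) * |A i k * B k j| ≤
      (s : ℤ) ^ ((k : ℕ) - i) * (t : ℤ) ^ (((j : ℕ) - i) - ((k : ℕ) - i)) *
        (((j : ℕ) - i).choose ((k : ℕ) - i) : ℤ) := by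
    intro k hk
    rw [mem_Icc, Fin.le_def, Fin.le_def] at hk
    have h1 := hs i k hk.1
    have h2 := ht k j hk.2
    have e : ((j : ℕ) - i) - ((k : ℕ) - i) = j - k := by omega
    have hc := Nat.choose_mul_factorial_mul_factorial
      (show (k : ℕ) - i ≤ (j : ℕ) - i by omega)
    rw [e] at hc ⊢
    rw [← hc, abs_mul]
    calc ((((j : ℕ) - i).choose ((k : ℕ) - i) * ((k : ℕ) - i)! * ((j : ℕ) - k)! : ℕ) : ℤ) *
          (|A i k| * |B k j|)
        = ((((k : ℕ) - i)! : ℤ) * |A i k|) * ((((j : ℕ) - k)! : ℤ) * |B k j|) *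
          (((j : ℕ) - i).choose ((k : ℕ) - i) : ℤ) := by push_cast; ring
      _ ≤ _ := by gcongr
  calc (((j : ℕ) - i)! : ℤ) * |∑ k ∈ Icc i j, A i k * B k j|
      ≤ (((j : ℕ) - i)! : ℤ) * ∑ k ∈ Icc i j, |A i k * B k j| := by
        exact mul_le_mul_of_nonneg_left (abs_sum_le_sum_abs _ _) (by positivity)
    _ ≤ ∑ k ∈ Icc i j, (s : ℤ) ^ ((k : ℕ) - i) * (t : ℤ) ^ (((j : ℕ) - i) - ((k : ℕ) - i)) *
        (((j : ℕ) - i).choose ((k : ℕ) - i) : ℤ) := by rw [mul_sum]; exact sum_le_sum key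
    _ = ∑ m ∈ range ((j : ℕ) - i + 1), (s : ℤ) ^ m * (t : ℤ) ^ ((j : ℕ) - i - m) *
          (((j : ℕ) - i).choose m : ℤ) := by
        refine sum_nbij (fun k => (k : ℕ) - i) ?_ ?_ ?_ fun _ _ => rfl
        · intro k hk
          simp only [mem_Icc, Fin.le_def, mem_range] at hk ⊢
          omega
        · intro k hk l hl h
          simp only [coe_Icc, Set.mem_Icc, Fin.le_def] at hk hl h
          ext
          omega
        · intro m hm
          simp only [coe_range, Set.mem_Iio] at hm
          have hj := j.2
          have hij' : (i : ℕ) ≤ j := hij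
          refine ⟨⟨i + m, by omega⟩, ?_, by simp⟩
          simp only [coe_Icc, Set.mem_Icc, Fin.le_def]
          omega
    _ = ((s + t : ℕ) : ℤ) ^ ((j : ℕ) - i) := by rw [Nat.cast_add, add_pow]

lemma abs_le_of_sizeLE {s : ℕ} {A : Matrix (Fin d) (Fin d) ℤ} (h : SizeLE s A) {i j : Fin d}
    (hij : i ≤ j) : |A i j| ≤ (s : ℤ) ^ (j - i : ℕ) := by
  refine le_trans ?_ (h i j hij)
  exact le_mul_of_one_le_left (abs_nonneg _) (by exact_mod_cast Nat.factorial_pos _)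

lemma abs_diag_eq_one (A : (upperTriangular d ℤ)ˣ) (i : Fin d) : |A.1.1 i i| = 1 := by
  have h : (A.1.1 * (A⁻¹).1.1) i i = 1 := by
    rw [← Submonoid.coe_mul, Units.mul_inv, Submonoid.coe_one, Matrix.one_apply_eq]
  rw [mul_apply_eq_sum_Icc A.1.2 (A⁻¹).1.2, Icc_self, sum_singleton] at h
  exact Int.isUnit_iff_abs_eq.1 (IsUnit.of_mul_eq_one _ h)

/-- On the diagonal `SizeLE` requires `|A i i| ≤ 1` whatever `s` is; invertibility over `ℤ` provides
this. The other entries are bounded by taking `s` large. -/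
lemma exists_sizeLE (A : (upperTriangular d ℤ)ˣ) : ∃ s, SizeLE s A.1.1 := by
  refine ⟨∑ p : Fin d × Fin d, ((p.2 - p.1 : ℕ)! * (A.1.1 p.1 p.2).natAbs), fun i j hij => ?_⟩
  rcases hij.eq_or_lt with rfl | h
  · simp [abs_diag_eq_one]
  · have h1 : (j - i : ℕ)! * (A.1.1 i j).natAbs ≤
        ∑ p : Fin d × Fin d, ((p.2 - p.1 : ℕ)! * (A.1.1 p.1 p.2).natAbs) :=
      single_le_sum (f := fun p : Fin d × Fin d => (p.2 - p.1 : ℕ)! * (A.1.1 p.1 p.2).natAbs)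
        (fun _ _ => Nat.zero_le _) (mem_univ (i, j))
    have h2 := h1.trans (Nat.le_self_pow (show (j - i : ℕ) ≠ 0 by
      rw [Fin.lt_def] at h; omega) _)
    rw [Int.abs_eq_natAbs]
    exact_mod_cast h2

lemma finite_sizeLE (d s : ℕ) : {A : (upperTriangular d ℤ)ˣ | SizeLE s A.1.1}.Finite := by
  let B : ℤ := ((s : ℤ) + 1) ^ d
  refine ((Set.finite_Icc (fun _ _ => -B : Fin d → Fin d → ℤ) fun _ _ => B).preimage
    (f := fun A : (upperTriangular d ℤ)ˣ => (A.1.1 : Fin d → Fin d → ℤ)) ?_).subset ?_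
  · intro A _ A' _ h
    exact Units.ext (Subtype.ext h)
  · intro A hA
    have : ∀ i j, |A.1.1 i j| ≤ B := by
      intro i j
      rcases lt_or_ge j i with h | h
      · rw [A.1.2 h, abs_zero]; positivity
      · refine (abs_le_of_sizeLE hA h).trans ?_
        have : (j - i : ℕ) ≤ d := by omega
        calc (s : ℤ) ^ (j - i : ℕ) ≤ ((s : ℤ) + 1) ^ (j - i : ℕ) := by gcongr; omega
          _ ≤ B := pow_le_pow_right₀ (by omega) this
    exact ⟨fun i j => (abs_le.1 (this i j)).1, fun i j => (abs_le.1 (this i j)).2⟩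

/-- Contraction: dilation scales the entry `(i, j)` by `q ^ (j - i)`, exactly the ratio of the
bounds for `q * s` and `s`. -/
lemma SizeLE.of_dilation {s q : ℕ} (hq : q ≠ 0) {A : upperTriangular d ℤ}
    (h : SizeLE (q * s) (dilation d (q : ℤ) A).1) : SizeLE s A.1 := by
  intro i j hij
  have := h i j hij
  rw [dilation_apply, abs_mul, abs_pow, Nat.abs_cast, Nat.cast_mul, mul_pow] at this
  refine le_of_mul_le_mul_left (a := (q : ℤ) ^ (j - i : ℕ)) ?_ (by positivity)
  linarith

/-- A matrix congruent to `1` modulo `q ^ d` has its `k`-th superdiagonal divisible by `q ^ k`, as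
`k < d`. The image thus contains a congruence subgroup, the kernel of a map to a finite group. -/
lemma finiteIndex_range_dilation (d : ℕ) {q : ℕ} (hq : q ≠ 0) :
    (Units.map (dilation d (q : ℤ))).range.FiniteIndex := by
  have : NeZero (q ^ d) := ⟨pow_ne_zero d hq⟩
  let f : (upperTriangular d ℤ)ˣ →* (Matrix (Fin d) (Fin d) (ZMod (q ^ d)))ˣ :=
    Units.map ((Int.castRingHom (ZMod (q ^ d))).mapMatrix.toMonoidHom.comp
      (upperTriangular d ℤ).subtype)
  have hdvd : ∀ A ∈ f.ker, ∃ B, dilation d (q : ℤ) B = A.1 := by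
    intro A hA
    refine exists_dilation_eq _ fun i j hij => ?_
    have h0 : ((A.1.1 i j : ℤ) : ZMod (q ^ d)) = 0 := by
      have := congrArg (fun M : (Matrix (Fin d) (Fin d) (ZMod (q ^ d)))ˣ => M.1 i j)
        (MonoidHom.mem_ker.1 hA)
      simpa [f, Matrix.one_apply_ne hij.ne] using this
    rw [ZMod.intCast_zmod_eq_zero_iff_dvd, Nat.cast_pow] at h0
    exact (pow_dvd_pow _ (by omega)).trans h0
  have hle : f.ker ≤ (Units.map (dilation d (q : ℤ))).range := by
    intro A hA
    obtain ⟨B, hB⟩ := hdvd A hA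
    -- The preimage of the inverse shows that `B` is a unit.
    obtain ⟨B', hB'⟩ := hdvd A⁻¹ (inv_mem hA)
    have hinj : Function.Injective (dilation d (q : ℤ)) :=
      dilation_injective (by exact_mod_cast hq)
    refine ⟨⟨B, B', hinj ?_, hinj ?_⟩, Units.ext hB⟩
    · rw [map_mul, hB, hB', map_one, Units.mul_inv]
    · rw [map_mul, hB, hB', map_one, Units.inv_mul]
  exact Subgroup.finiteIndex_of_le hle

lemma sizeLE_mul (A B : (upperTriangular d ℤ)ˣ) {s t : ℕ} (hs : SizeLE s A.1.1)
    (ht : SizeLE t B.1.1) : SizeLE (s + t) (A * B).1.1 :=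
  SizeLE.mul A.1.2 B.1.2 hs ht

lemma exists_sizeLE_finite {ι : Type*} [Finite ι] (f : ι → (upperTriangular d ℤ)ˣ) :
    ∃ s, ∀ i, SizeLE s (f i).1.1 := by
  cases nonempty_fintype ι
  choose s hs using fun i => exists_sizeLE (f i)
  exact ⟨∑ i, s i, fun i => (hs i).mono (single_le_sum (fun _ _ => Nat.zero_le _) (mem_univ i))⟩

lemma sizeLE_prod {s : ℕ} (l : List (upperTriangular d ℤ)ˣ) (h : ∀ A ∈ l, SizeLE s A.1.1) :
    SizeLE (l.length * s) l.prod.1.1 := by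
  induction l with
  | nil => simpa using sizeLE_one
  | cons A l ih =>
    rw [List.prod_cons, List.length_cons, add_mul, one_mul, add_comm]
    exact sizeLE_mul _ _ (h A (by simp)) (ih fun B hB => h B (by simp [hB]))

end upperTriangular

open upperTriangular in
/-- If the letters can be represented by invertible integral upper triangular matrices such that the
represented words with value `1` are the same, the word problem is solvable in linear time. -/
theorem wordProblemLinearTime_of_upperTriangular {G : Type*} [Group G] {S : Set G} (hS : S.Finite)
    {d : ℕ} (φ : symAlphabet S → (upperTriangular d ℤ)ˣ)
    (hφ : ∀ w : List (symAlphabet S), wordValue w = 1 ↔ (w.map φ).prod = 1) :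
    WordProblemLinearTime S := by
  classical
  have := symAlphabet_finite hS
  -- Two letters double the size; a factor `3` leaves room for the representatives, since `s₂ + (s +
  -- s + s₁) ≤ 3 * s` for the `s` below.
  let δ : (upperTriangular d ℤ)ˣ →* (upperTriangular d ℤ)ˣ := Units.map (dilation d ((3 : ℕ) : ℤ))
  have hδ : Function.Injective δ :=
    Units.map_injective (dilation_injective (by norm_num))
  have : δ.range.FiniteIndex := finiteIndex_range_dilation d (by norm_num)
  let C := (upperTriangular d ℤ)ˣ ⧸ δ.range
  -- The trivial coset must be represented by `1` itself, so that the neutral carry has value `1`.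
  let rep : C → (upperTriangular d ℤ)ˣ := fun r => if r = ((1 : (upperTriangular d ℤ)ˣ) : C) then 1 else r.out
  have hrep : ∀ r, (rep r : C) = r := by
    intro r
    by_cases h : r = ((1 : (upperTriangular d ℤ)ˣ) : C)
    · simp [rep, h]
    · simp [rep, h]
  obtain ⟨s₁, h₁⟩ := exists_sizeLE_finite rep
  obtain ⟨s₂, h₂⟩ := exists_sizeLE_finite fun r => (rep r)⁻¹
  obtain ⟨s₃, h₃⟩ := exists_sizeLE_finite φ
  let s := s₁ + s₂ + s₃
  let E := {A : (upperTriangular d ℤ)ˣ | SizeLE s A.1.1}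
  have : Finite E := (finite_sizeLE d s).to_subtype
  refine wordProblemLinearTime_of_halving hS δ (E := E) (R := C) (fun A => A.1) rep
    Subtype.val_injective ⟨1, sizeLE_one.mono (Nat.zero_le _)⟩ rfl
    ((1 : (upperTriangular d ℤ)ˣ) : C) (if_pos rfl) ?_ ?_
    (fun a => ⟨φ a, (h₃ a).mono (by omega)⟩) hφ
  · rintro ⟨A, hA⟩ ⟨B, hB⟩ r
    let g := A * B * rep r
    have hg : (rep (g : C))⁻¹ * g ∈ δ.range := QuotientGroup.eq.1 (hrep g)
    obtain ⟨e, he⟩ := hg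
    have hs : SizeLE (s₂ + (s + s + s₁)) (δ e).1.1 := by
      rw [he]
      exact sizeLE_mul _ _ (h₂ _) (sizeLE_mul _ _ (sizeLE_mul _ _ hA hB) (h₁ r))
    have he' : SizeLE s e.1.1 :=
      SizeLE.of_dilation (q := 3) (by norm_num) (hs.mono (by omega))
    exact ⟨(g, ⟨e, he'⟩), by rw [he, mul_inv_cancel_left]⟩
  · intro r g h
    have hr : r = ((1 : (upperTriangular d ℤ)ˣ) : C) := by
      rw [← hrep r, eq_inv_of_mul_eq_one_left h, ← map_inv, QuotientGroup.eq]
      exact ⟨g, by simp⟩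
    refine ⟨hr, hδ ?_⟩
    rw [map_one]
    simpa [rep, hr] using h

/-! ### Finitely generated nilpotent groups -/

namespace Subgroup

open scoped commutatorElement

variable {G : Type*} [Group G]

/-- The ascending chain condition for the subgroups of `H` passes to an extension of `H` by a cyclic
group. -/
lemma wellFoundedGT_Iic_sup_zpowers {K : Subgroup G} [K.Normal] (x : G)
    [WellFoundedGT (Set.Iic K)] : WellFoundedGT (Set.Iic (K ⊔ zpowers x)) := by
  have : WellFoundedGT (Subgroup (Multiplicative ℤ)) :=
    ((AddSubgroup.toIntSubmodule (M := ℤ)).symm.trans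
      AddSubgroup.toSubgroup).symm.toOrderEmbedding.wellFoundedGT
  -- For nested subgroups `L ≤ L'`, equality follows from equal intersections with `K` and equal
  -- images modulo `K`. The latter are recorded as subgroups of `ℤ`.
  let f : Set.Iic (K ⊔ zpowers x) → Set.Iic K × Subgroup (Multiplicative ℤ) :=
    fun L => (⟨L.1 ⊓ K, Set.mem_Iic.2 inf_le_right⟩, (K ⊔ L.1).comap (zpowersHom G x))
  have hmono : Monotone f := fun L L' h =>
    ⟨inf_le_inf_right K h, Subgroup.comap_mono (sup_le_sup_left (Subtype.coe_le_coe.2 h) K)⟩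
  have hf : StrictMono f := by
    refine fun L L' h => lt_of_le_of_ne (hmono h.le) fun heq => h.ne (le_antisymm h.le ?_)
    intro l' hl'
    have h1 : L.1 ⊓ K = L'.1 ⊓ K := congrArg (fun p => (p.1 : Subgroup G)) heq
    have h2 : (K ⊔ L.1).comap (zpowersHom G x) = (K ⊔ L'.1).comap (zpowersHom G x) :=
      congrArg Prod.snd heq
    obtain ⟨k, hk, y, ⟨n, rfl⟩, rfl⟩ := mem_sup_of_normal_left.1 (L'.2 hl')
    have h3 : Multiplicative.ofAdd n ∈ (K ⊔ L'.1).comap (zpowersHom G x) := by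
      have := mul_mem (inv_mem (mem_sup_left (T := L'.1) hk)) (mem_sup_right (S := K) hl')
      simpa using this
    rw [← h2] at h3
    have h4 : k * x ^ n ∈ K ⊔ L.1 := mul_mem (mem_sup_left hk) (by simpa using h3)
    obtain ⟨k₂, hk₂, l, hl, e⟩ := mem_sup_of_normal_left.1 h4
    have h5 : k₂ ∈ L.1 ⊓ K := by
      rw [h1]
      refine ⟨?_, hk₂⟩
      rw [eq_mul_inv_of_mul_eq e]
      exact mul_mem hl' (L'.1.inv_mem (h.le hl))
    change k * x ^ n ∈ L.1
    rw [← e]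
    exact mul_mem h5.1 hl
  exact hf.wellFoundedGT

/-- Commutators of elements of `M` with elements of `G` lie in the `(i + 1)`-st term, hence in `M`.
-/
lemma normal_of_lowerCentralSeries_le {M : Subgroup G} {i : ℕ}
    (h₁ : (⊤ : Subgroup G).lowerCentralSeries (i + 1) ≤ M)
    (h₂ : M ≤ (⊤ : Subgroup G).lowerCentralSeries i) : M.Normal := by
  refine ⟨fun m hm g => ?_⟩
  have : ⁅m, g⁆ ∈ M := h₁ (commutator_mem_commutator (h₂ hm) (mem_top g))
  have h := mul_mem (inv_mem this) hm
  simpa [commutatorElement_def, mul_assoc] using h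

/-- If `T` generates the `i`-th term modulo the next and `S` generates `G`, the commutators `⁅t, s⁆`
generate the next quotient. Let `M` be generated by these and the `(i + 2)`-nd term. In `G ⧸ M` each
`t ∈ T` commutes with the generators, so the image of the `i`-th term is central and the `(i +
1)`-st term lies in `M`. -/
lemma exists_finset_lowerCentralSeries [Group.FG G] (i : ℕ) : ∃ T : Finset G,
    (⊤ : Subgroup G).lowerCentralSeries i =
      closure T ⊔ (⊤ : Subgroup G).lowerCentralSeries (i + 1) := by
  classical
  obtain ⟨S, hS⟩ := (Group.fg_def.1 ‹Group.FG G›)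
  induction i with
  | zero => exact ⟨S, by simp [hS]⟩
  | succ i ih =>
    obtain ⟨T, hT⟩ := ih
    refine ⟨(T ×ˢ S).image fun p => ⁅p.1, p.2⁆, ?_⟩
    set γ := (⊤ : Subgroup G).lowerCentralSeries with hγ
    set M := closure (((T ×ˢ S).image fun p => ⁅p.1, p.2⁆ : Finset G) : Set G) ⊔ γ (i + 1 + 1)
      with hM
    have hTi : ∀ t ∈ T, t ∈ γ i := fun t ht => by
      rw [hT]; exact mem_sup_left (subset_closure ht)
    have hle : M ≤ γ (i + 1) := by
      refine sup_le ((closure_le _).2 ?_) (lowerCentralSeries_antitone _ (Nat.le_succ _))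
      intro x hx
      simp only [Finset.coe_image, Set.mem_image, Finset.mem_coe, Finset.mem_product] at hx
      obtain ⟨p, ⟨hp1, -⟩, rfl⟩ := hx
      exact commutator_mem_commutator (hTi _ hp1) (mem_top _)
    have hn : M.Normal := normal_of_lowerCentralSeries_le le_sup_right hle
    refine le_antisymm ?_ hle
    have hcomm : ∀ a b : G, ⁅a, b⁆ ∈ M ↔ Commute (a : G ⧸ M) b := by
      intro a b
      rw [← QuotientGroup.eq_one_iff, ← commutatorElement_eq_one_iff_commute]
      rfl
    have hcent : γ i ≤ (center (G ⧸ M)).comap (QuotientGroup.mk' M) := by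
      rw [hT]
      refine sup_le ((closure_le _).2 fun t ht => ?_) fun t ht => ?_
      · have : closure (S : Set G) ≤ (centralizer {(t : G ⧸ M)}).comap (QuotientGroup.mk' M) := by
          refine (closure_le _).2 fun s hs => ?_
          refine mem_centralizer_singleton_iff.2 ((hcomm t s).1 (mem_sup_left (subset_closure ?_))).symm
          simp only [Finset.coe_image, Set.mem_image, Finset.mem_coe, Finset.mem_product]
          exact ⟨(t, s), ⟨ht, hs⟩, rfl⟩
        refine mem_center_iff.2 fun y => ?_
        obtain ⟨y, rfl⟩ := QuotientGroup.mk_surjective y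
        have hy : y ∈ closure (S : Set G) := hS ▸ mem_top y
        exact mem_centralizer_singleton_iff.1 (this hy)
      · refine mem_center_iff.2 fun y => ?_
        obtain ⟨y, rfl⟩ := QuotientGroup.mk_surjective y
        exact ((hcomm t y).1
          (mem_sup_right (commutator_mem_commutator ht (mem_top _)))).symm
    refine commutator_le.2 fun a ha b _ => (hcomm a b).2 ?_
    exact (mem_center_iff.1 (hcent ha) b).symm

/-- The subgroups of a finitely generated nilpotent group satisfy the ascending chain condition. -/
theorem wellFoundedGT_of_isNilpotent [Group.FG G] [Group.IsNilpotent G] :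
    WellFoundedGT (Subgroup G) := by
  classical
  have step : ∀ i, WellFoundedGT (Set.Iic ((⊤ : Subgroup G).lowerCentralSeries (i + 1))) →
      WellFoundedGT (Set.Iic ((⊤ : Subgroup G).lowerCentralSeries i)) := by
    intro i hi
    obtain ⟨T, hT⟩ := exists_finset_lowerCentralSeries (G := G) i
    -- The generators are adjoined one at a time; every intermediate subgroup is normal because it
    -- lies between consecutive terms of the series.
    have key : ∀ U ⊆ T, WellFoundedGT
        (Set.Iic ((⊤ : Subgroup G).lowerCentralSeries (i + 1) ⊔ closure (U : Set G))) := by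
      intro U
      induction U using Finset.induction_on with
      | empty =>
        intro _
        rw [Finset.coe_empty, closure_empty, sup_bot_eq]
        exact hi
      | insert a U _ ih =>
        intro hU
        have hU' : U ⊆ T := (Finset.subset_insert a U).trans hU
        have := ih hU'
        have hn : ((⊤ : Subgroup G).lowerCentralSeries (i + 1) ⊔ closure (U : Set G)).Normal := by
          refine normal_of_lowerCentralSeries_le le_sup_left (i := i) ?_
          rw [hT, sup_comm]
          exact sup_le_sup_right (closure_mono (by exact_mod_cast hU')) _
        have h := wellFoundedGT_Iic_sup_zpowers
          (K := (⊤ : Subgroup G).lowerCentralSeries (i + 1) ⊔ closure (U : Set G)) a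
        rwa [sup_assoc, zpowers_eq_closure, ← closure_union, Set.union_singleton,
          ← Finset.coe_insert] at h
    rw [hT, sup_comm]
    exact key T subset_rfl
  obtain ⟨n, hn⟩ := nilpotent_iff_lowerCentralSeries.1 ‹Group.IsNilpotent G›
  have h0 : WellFoundedGT (Set.Iic ((⊤ : Subgroup G).lowerCentralSeries n)) := by
    rw [hn, Set.Iic_bot]
    infer_instance
  have h : WellFoundedGT (Set.Iic ((⊤ : Subgroup G).lowerCentralSeries 0)) :=
    Nat.decreasingInduction (motive := fun i _ =>
      WellFoundedGT (Set.Iic ((⊤ : Subgroup G).lowerCentralSeries i)))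
      (fun i _ => step i) h0 (Nat.zero_le n)
  have hf : StrictMono (fun L : Subgroup G =>
      (⟨L, Set.mem_Iic.2 le_top⟩ : Set.Iic ((⊤ : Subgroup G).lowerCentralSeries 0))) := fun _ _ h => h
  exact hf.wellFoundedGT

lemma wellFoundedGT_quotient [WellFoundedGT (Subgroup G)] (H : Subgroup G) [H.Normal] :
    WellFoundedGT (Subgroup (G ⧸ H)) := by
  have hf : StrictMono (Subgroup.comap (QuotientGroup.mk' H)) :=
    Monotone.strictMono_of_injective (fun _ _ h => Subgroup.comap_mono h)
      (comap_injective (QuotientGroup.mk'_surjective H))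
  exact hf.wellFoundedGT

/-! ### Roots and isolated subgroups in torsion-free nilpotent groups -/

/-- In a torsion-free group, roots of elements of a term of the upper central series that lie in the
next term are in the same term. -/
lemma mem_upperCentralSeries_of_pow_mem (htf : ∀ g : G, IsOfFinOrder g → g = 1) {n : ℕ}
    (hn : 0 < n) (i : ℕ) : ∀ g ∈ upperCentralSeries G (i + 1), g ^ n ∈ upperCentralSeries G i →
      g ∈ upperCentralSeries G i := by
  induction i with
  | zero =>
    intro g _ h
    exact mem_bot.2 (htf g (isOfFinOrder_iff_pow_eq_one.2 ⟨n, hn, mem_bot.1 h⟩))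
  | succ i ih =>
    intro g hg h
    refine mem_upperCentralSeries_succ_iff.2 fun y => ?_
    have hc := mem_upperCentralSeries_succ_iff.1 hg y
    refine ih _ hc ?_
    let π := QuotientGroup.mk' (upperCentralSeries G i)
    have hcent : ∀ c ∈ upperCentralSeries G (i + 1), ∀ z, Commute (π c) (π z) := by
      intro c hc z
      have := (QuotientGroup.eq_one_iff (N := upperCentralSeries G i) _).2
        (mem_upperCentralSeries_succ_iff.1 hc z)
      exact commutatorElement_eq_one_iff_commute.1 this
    -- Modulo the `i`-th term, `g = ⁅g, y⁆ * (y * g * y⁻¹)` with commuting factors, and `g ^ n` is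
    -- central. Taking `n`-th powers gives `⁅g, y⁆ ^ n = 1` there, and the induction hypothesis
    -- applies to `⁅g, y⁆`.
    have h1 : π y * π g ^ n * (π y)⁻¹ = π g ^ n := by
      have := (hcent _ h y).symm.eq
      rw [map_pow] at this
      rw [this, mul_inv_cancel_right]
    have h2 : Commute (π ⁅g, y⁆) (π (y * g * y⁻¹)) := hcent _ hc _
    have h3 : π ⁅g, y⁆ * π (y * g * y⁻¹) = π g := by
      rw [← map_mul, commutatorElement_def]
      congr 1
      group
    have h4 := h2.mul_pow n
    rw [h3, map_mul, map_mul, map_inv, conj_pow, h1, right_eq_mul, ← map_pow] at h4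
    exact (QuotientGroup.eq_one_iff _).1 h4

/-- In a torsion-free nilpotent group, the roots of central elements are central. -/
lemma mem_center_of_pow_mem [Group.IsNilpotent G] (htf : ∀ g : G, IsOfFinOrder g → g = 1) {n : ℕ}
    (hn : 0 < n) {g : G} (h : g ^ n ∈ center G) : g ∈ center G := by
  rw [← upperCentralSeries_one] at h ⊢
  obtain ⟨c, hc⟩ := Group.IsNilpotent.nilpotent G
  have key : ∀ i, g ∈ upperCentralSeries G (i + 1) → g ∈ upperCentralSeries G 1 := by
    intro i
    induction i with
    | zero => exact id
    | succ i ih =>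
      exact fun hg => ih (mem_upperCentralSeries_of_pow_mem htf hn (i + 1) g hg
        (upperCentralSeries_mono G (by omega) h))
  exact key c (upperCentralSeries_mono G (Nat.le_succ c) (hc ▸ mem_top g))

/-- A nontrivial torsion-free nilpotent group whose subgroups satisfy the ascending chain condition
has an infinite cyclic central subgroup that is isolated. -/
lemma exists_isolated_central [Nontrivial G] [Group.IsNilpotent G] [WellFoundedGT (Subgroup G)]
    (htf : ∀ g : G, IsOfFinOrder g → g = 1) :
    ∃ t ∈ center G, t ≠ 1 ∧ ∀ g : G, ∀ n : ℕ, 0 < n → g ^ n ∈ zpowers t → g ∈ zpowers t := by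
  obtain ⟨⟨z, hz⟩, hz0⟩ := ne_bot_iff_exists_ne_one.1 (Group.IsNilpotent.center_ne_bot G)
  have hz1 : z ≠ 1 := fun h => hz0 (Subtype.ext h)
  obtain ⟨_, ⟨t, ht, ht1, rfl⟩, hmax⟩ := wellFounded_gt.has_min
    {L : Subgroup G | ∃ t ∈ center G, t ≠ 1 ∧ L = zpowers t} ⟨_, z, hz, hz1, rfl⟩
  refine ⟨t, ht, ht1, fun g n hn hg => ?_⟩
  have hgc : g ∈ center G := mem_center_of_pow_mem htf hn ((zpowers_le.2 ht) hg)
  obtain ⟨k, hk⟩ := hg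
  replace hk : t ^ k = g ^ n := hk
  have hcomm : Commute g t := (mem_center_iff.1 ht g)
  -- Torsion-freeness allows the common factor of the exponents in `g ^ n = t ^ k` to be cancelled.
  -- With coprime exponents, Bézout gives `s` having both `g` and `t` as powers, and maximality of
  -- `zpowers t` forces `zpowers s = zpowers t`.
  obtain ⟨d, n', k', hd, hcop, hn', hk'⟩ : ∃ d n' k' : ℤ, d ≠ 0 ∧ IsCoprime n' k' ∧
      (n : ℤ) = n' * d ∧ k = k' * d := by
    have hg0 : (Int.gcd n k : ℤ) ≠ 0 := by
      simp [Int.gcd_eq_zero_iff, hn.ne']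
    refine ⟨Int.gcd n k, n / Int.gcd n k, k / Int.gcd n k, hg0, ?_,
      (Int.ediv_mul_cancel (Int.gcd_dvd_left _ _)).symm,
      (Int.ediv_mul_cancel (Int.gcd_dvd_right _ _)).symm⟩
    rw [Int.isCoprime_iff_gcd_eq_one]
    exact Int.gcd_ediv_gcd_ediv_gcd (by exact_mod_cast Nat.pos_of_ne_zero (by exact_mod_cast hg0))
  have h1 : g ^ n' = t ^ k' := by
    have h2 : (g ^ n' * (t ^ k')⁻¹) ^ d = 1 := by
      rw [((hcomm.zpow_zpow n' k').inv_right).mul_zpow, inv_zpow, ← zpow_mul, ← zpow_mul, ← hn',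
        ← hk', zpow_natCast, hk, mul_inv_cancel]
    exact mul_inv_eq_one.1 (htf _ (isOfFinOrder_iff_zpow_eq_one.2 ⟨d, hd, h2⟩))
  obtain ⟨u, v, huv⟩ := hcop
  let s := g ^ v * t ^ u
  have hs : ∀ m : ℤ, s ^ m = g ^ (v * m) * t ^ (u * m) := fun m => by
    rw [(hcomm.zpow_zpow v u).mul_zpow, ← zpow_mul, ← zpow_mul]
  have hst : s ^ n' = t := by
    rw [hs, mul_comm v, zpow_mul, h1, ← zpow_mul, ← zpow_add,
      show k' * v + u * n' = 1 by linarith, zpow_one]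
  have hsg : s ^ k' = g := by
    rw [hs, mul_comm u, zpow_mul t, ← h1, ← zpow_mul, ← zpow_add,
      show v * k' + n' * u = 1 by linarith, zpow_one]
  have hle : zpowers t ≤ zpowers s := zpowers_le.2 ⟨n', hst⟩
  have hs1 : s ≠ 1 := fun h => ht1 (by rw [← hst, h, one_zpow])
  have heq : zpowers s = zpowers t := by
    by_contra hne
    exact hmax _ ⟨s, mul_mem (zpow_mem hgc v) (zpow_mem ht u), hs1, rfl⟩
      (lt_of_le_of_ne hle (Ne.symm hne))
  rw [← heq]
  exact ⟨k', hsg⟩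

end Subgroup

/-! ### Powers of augmentation ideals of torsion-free nilpotent groups -/

namespace GroupAlgebra

open scoped commutatorElement

variable {G : Type*} [Group G]

/-- The group elements in the rational group algebra. -/
noncomputable abbrev e : G →* MonoidAlgebra ℚ G := MonoidAlgebra.of ℚ G

/-- The linear extension of a function on the group to the group algebra. -/
noncomputable def extend {V : Type*} [AddCommGroup V] [Module ℚ V] (f : G → V) :
    MonoidAlgebra ℚ G →ₗ[ℚ] V :=
  (MonoidAlgebra.basis G ℚ).constr ℚ f

lemma extend_e {V : Type*} [AddCommGroup V] [Module ℚ V] (f : G → V) (g : G) :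
    extend f (e g) = f g := by
  have := (MonoidAlgebra.basis G ℚ).constr_basis ℚ f g
  rwa [MonoidAlgebra.basis_apply] at this

/-- The augmentation ideal of the group algebra of a subgroup. -/
noncomputable def aug (H : Subgroup G) : Submodule ℚ (MonoidAlgebra ℚ G) :=
  Submodule.span ℚ ((fun h => e h - 1) '' (H : Set G))

/-- The group algebra of a subgroup. -/
noncomputable def subalg (H : Subgroup G) : Submodule ℚ (MonoidAlgebra ℚ G) :=
  Submodule.span ℚ (e '' (H : Set G))

lemma sub_one_mem_aug {H : Subgroup G} {h : G} (hh : h ∈ H) : e h - 1 ∈ aug H :=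
  Submodule.subset_span ⟨h, hh, rfl⟩

lemma aug_mul_aug_le (H : Subgroup G) : aug H * aug H ≤ aug H := by
  rw [aug, Submodule.span_mul_span, Submodule.span_le]
  rintro _ ⟨_, ⟨g, hg, rfl⟩, _, ⟨h, hh, rfl⟩, rfl⟩
  have : (e g - 1) * (e h - 1) = (e (g * h) - 1) - (e g - 1) - (e h - 1) := by
    rw [map_mul]; noncomm_ring
  change (e g - 1) * (e h - 1) ∈ aug H
  rw [this]
  exact sub_mem (sub_mem (sub_one_mem_aug (mul_mem hg hh)) (sub_one_mem_aug hg))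
    (sub_one_mem_aug hh)

/-- The power `aug H ^ 0` consists of the scalars only, hence the condition `0 < m`. -/
lemma aug_pow_le_aug_pow (H : Subgroup G) {m n : ℕ} (hm : 0 < m) (hmn : m ≤ n) :
    aug H ^ n ≤ aug H ^ m := by
  induction n, hmn using Nat.le_induction with
  | base => exact le_rfl
  | succ n hn ih =>
    refine le_trans ?_ ih
    obtain ⟨k, rfl⟩ := Nat.exists_eq_succ_of_ne_zero (hm.trans_le hn).ne'
    rw [pow_succ, pow_succ, mul_assoc]
    exact mul_le_mul_right (aug_mul_aug_le H) _

/-- Products of elements `h - 1` with `h ∈ H`, weighted by the depth of `h` in the lower central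
series. -/
inductive Weighted (H : Subgroup G) : ℕ → MonoidAlgebra ℚ G → Prop
  | one : Weighted H 0 1
  | mul {j w : ℕ} {h : G} {a : MonoidAlgebra ℚ G} : h ∈ H →
      h ∈ (⊤ : Subgroup G).lowerCentralSeries j → Weighted H w a →
      Weighted H (w + j + 1) ((e h - 1) * a)

/-- The span of the products of weight at least `w`. -/
noncomputable def weightGE (H : Subgroup G) (w : ℕ) : Submodule ℚ (MonoidAlgebra ℚ G) :=
  Submodule.span ℚ {a | ∃ v, w ≤ v ∧ Weighted H v a}

lemma weightGE_anti (H : Subgroup G) {v w : ℕ} (h : v ≤ w) : weightGE H w ≤ weightGE H v :=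
  Submodule.span_mono fun _ ⟨u, hu, ha⟩ => ⟨u, h.trans hu, ha⟩

lemma mul_mem_weightGE {H : Subgroup G} {j w : ℕ} {h : G} (hh : h ∈ H)
    (hj : h ∈ (⊤ : Subgroup G).lowerCentralSeries j) {a : MonoidAlgebra ℚ G}
    (ha : a ∈ weightGE H w) : (e h - 1) * a ∈ weightGE H (w + j + 1) := by
  induction ha using Submodule.span_induction with
  | mem a ha =>
    obtain ⟨v, hv, ha⟩ := ha
    exact Submodule.subset_span ⟨_, by omega, ha.mul hh hj⟩
  | zero => simp
  | add a b _ _ iha ihb => rw [mul_add]; exact add_mem iha ihb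
  | smul c a _ ih => rw [mul_smul_comm]; exact Submodule.smul_mem _ _ ih

lemma e_mul_mem_weightGE {H : Subgroup G} {w : ℕ} {h : G} (hh : h ∈ H)
    {a : MonoidAlgebra ℚ G} (ha : a ∈ weightGE H w) : e h * a ∈ weightGE H w := by
  have h1 := weightGE_anti H (show w ≤ w + 0 + 1 by omega)
    (mul_mem_weightGE hh (j := 0) (Subgroup.mem_top h) ha)
  have := add_mem h1 ha
  rwa [sub_mul, one_mul, sub_add_cancel] at this

/-- Conjugation by `x` replaces a factor `h` by `⁅x, h⁆ * h`, and the commutator is one step deeper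
in the lower central series of `G`. The identity `e1` splits off the first factor for an induction
on the number of factors. -/
lemma conj_sub_mem_weightGE {H : Subgroup G} [H.Normal] {w : ℕ} (x : G)
    {a : MonoidAlgebra ℚ G} (ha : a ∈ weightGE H w) :
    e x * a * e x⁻¹ - a ∈ weightGE H (w + 1) := by
  have key : ∀ v a, Weighted H v a → e x * a * e x⁻¹ - a ∈ weightGE H (v + 1) := by
    intro v a hv
    induction hv with
    | one =>
      rw [mul_one, ← map_mul, mul_inv_cancel, map_one, sub_self]
      exact zero_mem _
    | @mul j w h a hh hj hw ih =>
      have ha : a ∈ weightGE H w := Submodule.subset_span ⟨w, le_rfl, hw⟩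
      have hxh : x * h * x⁻¹ ∈ H := Subgroup.Normal.conj_mem ‹_› h hh x
      have hxj : x * h * x⁻¹ ∈ (⊤ : Subgroup G).lowerCentralSeries j :=
        Subgroup.Normal.conj_mem inferInstance h hj x
      have hcj : x * h * x⁻¹ * h⁻¹ ∈ (⊤ : Subgroup G).lowerCentralSeries (j + 1) := by
        have := inv_mem (Subgroup.commutator_mem_commutator hj (Subgroup.mem_top x))
        rwa [commutatorElement_inv, commutatorElement_def] at this
      have e1 : e x * ((e h - 1) * a) * e x⁻¹ - (e h - 1) * a =
          (e (x * h * x⁻¹) - 1) * (e x * a * e x⁻¹ - a) +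
            (e (x * h * x⁻¹ * h⁻¹) - 1) * (e h * a) := by
        have hx : e x⁻¹ * e x = 1 := by rw [← map_mul, inv_mul_cancel, map_one]
        have hh' : e h⁻¹ * e h = 1 := by rw [← map_mul, inv_mul_cancel, map_one]
        have i1 : e (x * h * x⁻¹) * (e x * a * e x⁻¹) = e x * e h * a * e x⁻¹ := by
          simp only [map_mul, mul_assoc]
          rw [← mul_assoc (e x⁻¹) (e x), hx, one_mul]
        have i2 : e (x * h * x⁻¹ * h⁻¹) * (e h * a) = e (x * h * x⁻¹) * a := by
          rw [map_mul, mul_assoc, ← mul_assoc (e h⁻¹), hh', one_mul]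
        have i3 : (e (x * h * x⁻¹) - 1) * (e x * a * e x⁻¹ - a) +
            (e (x * h * x⁻¹ * h⁻¹) - 1) * (e h * a) =
            e (x * h * x⁻¹) * (e x * a * e x⁻¹) - e (x * h * x⁻¹) * a - e x * a * e x⁻¹ + a +
              (e (x * h * x⁻¹ * h⁻¹) * (e h * a)) - e h * a := by noncomm_ring
        rw [i3, i1, i2]
        noncomm_ring
      rw [e1]
      refine add_mem ?_ ?_
      · exact weightGE_anti H (by omega) (mul_mem_weightGE hxh hxj ih)
      · exact weightGE_anti H (by omega) (mul_mem_weightGE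
          (mul_mem hxh (inv_mem hh)) hcj (e_mul_mem_weightGE hh ha))
  induction ha using Submodule.span_induction with
  | mem a ha =>
    obtain ⟨v, hv, ha⟩ := ha
    exact weightGE_anti H (by omega) (key v a ha)
  | zero => simp
  | add a b _ _ iha ihb =>
    rw [mul_add, add_mul, add_sub_add_comm]
    exact add_mem iha ihb
  | smul c a _ ih =>
    rw [mul_smul_comm, smul_mul_assoc, ← smul_sub]
    exact Submodule.smul_mem _ _ ih

/-- A nonzero factor has weight at most `c`, so a nonzero product of weight at least `m * c` has at
least `m` factors. -/
lemma weightGE_le_aug_pow (H : Subgroup G) {c : ℕ} (hc : 0 < c)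
    (hG : (⊤ : Subgroup G).lowerCentralSeries c = ⊥) {m : ℕ} (hm : 0 < m) :
    weightGE H (m * c) ≤ aug H ^ m := by
  have key : ∀ v a, Weighted H v a → a = 0 ∨ ∃ k, v ≤ k * c ∧ a ∈ aug H ^ k := by
    intro v a hv
    induction hv with
    | one => exact .inr ⟨0, by simp, by rw [pow_zero]; exact Submodule.one_le.1 le_rfl⟩
    | @mul j w h a hh hj hw ih =>
      rcases ih with rfl | ⟨k, hk, ha⟩
      · exact .inl (mul_zero _)
      by_cases hjc : c ≤ j
      · have : h ∈ (⊤ : Subgroup G).lowerCentralSeries c :=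
          Subgroup.lowerCentralSeries_antitone _ hjc hj
        rw [hG, Subgroup.mem_bot] at this
        subst this
        exact .inl (by rw [map_one, sub_self, zero_mul])
      · refine .inr ⟨k + 1, ?_, ?_⟩
        · rw [add_mul, one_mul]; omega
        · rw [pow_succ']
          exact Submodule.mul_mem_mul (sub_one_mem_aug hh) ha
  refine Submodule.span_le.2 fun a ⟨v, hv, ha⟩ => ?_
  rcases key v a ha with rfl | ⟨k, hk, hak⟩
  · exact zero_mem _
  · exact aug_pow_le_aug_pow H hm (Nat.le_of_mul_le_mul_right (hv.trans hk) hc) hak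

section Extension

variable {H H' : Subgroup G} {t : G} {κ : G → ℤ}

/-- The retraction of the group algebra of `H ⋊ ⟨t⟩` onto that of `H` raises weights as much as
powers of the augmentation ideal. -/
lemma extend_mem_weightGE [H.Normal] (hκ : ∀ g ∈ H', g * t ^ (-κ g) ∈ H)
    (hmul : ∀ g ∈ H', ∀ h ∈ H', κ (g * h) = κ g + κ h) (w : ℕ) {a : MonoidAlgebra ℚ G}
    (ha : a ∈ aug H' ^ w) :
    a ∈ subalg H' ∧ extend (fun g => e (g * t ^ (-κ g))) a ∈ weightGE H w := by
  set Θ := extend (fun g => e (g * t ^ (-κ g))) with hΘ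
  have hΘe : ∀ g, Θ (e g) = e (g * t ^ (-κ g)) := extend_e _
  have hκ1 : κ 1 = 0 := by simpa using hmul 1 (one_mem _) 1 (one_mem _)
  -- The retraction is not multiplicative; left multiplication by `g` turns into multiplication by
  -- `g` on the left and by `t ^ (-κ g)` on the right.
  have hgb : ∀ g ∈ H', ∀ b ∈ subalg H',
      e g * b ∈ subalg H' ∧ Θ (e g * b) = e g * Θ b * e (t ^ (-κ g)) := by
    intro g hg b hb
    induction hb using Submodule.span_induction with
    | mem b hb =>
      obtain ⟨h, hh, rfl⟩ := hb
      rw [← map_mul]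
      refine ⟨Submodule.subset_span ⟨_, mul_mem hg hh, rfl⟩, ?_⟩
      rw [hΘe, hΘe, hmul g hg h hh, ← map_mul, ← map_mul, mul_assoc g (h * _), mul_assoc h,
        ← zpow_add, mul_assoc, neg_add_rev]
    | zero => simp
    | add b c _ _ ihb ihc =>
      rw [mul_add, map_add, map_add, ihb.2, ihc.2, mul_add, add_mul]
      exact ⟨add_mem ihb.1 ihc.1, rfl⟩
    | smul q b _ ih =>
      rw [mul_smul_comm, map_smul, map_smul, ih.2, mul_smul_comm, smul_mul_assoc]
      exact ⟨Submodule.smul_mem _ _ ih.1, rfl⟩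
  induction w generalizing a with
  | zero =>
    rw [pow_zero, Submodule.mem_one] at ha
    obtain ⟨q, rfl⟩ := ha
    rw [Algebra.algebraMap_eq_smul_one, ← map_one e, map_smul, hΘe, hκ1, neg_zero, zpow_zero,
      mul_one]
    refine ⟨Submodule.smul_mem _ _ (Submodule.subset_span ⟨1, one_mem _, rfl⟩),
      Submodule.smul_mem _ _ ?_⟩
    rw [map_one]
    exact Submodule.subset_span ⟨0, le_rfl, .one⟩
  | succ w ih =>
    have hle : aug H' ^ (w + 1) ≤ subalg H' ⊓ (weightGE H (w + 1)).comap Θ := by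
      rw [pow_succ', Submodule.mul_le]
      intro x hx b hb
      obtain ⟨hb1, hb2⟩ := ih hb
      induction hx using Submodule.span_induction with
      | mem x hx =>
        obtain ⟨g, hg, rfl⟩ := hx
        have hgb := hgb g hg b hb1
        constructor
        · change (e g - 1) * b ∈ subalg H'
          rw [sub_mul, one_mul]
          exact sub_mem hgb.1 hb1
        · change Θ ((e g - 1) * b) ∈ weightGE H (w + 1)
          rw [sub_mul, one_mul, map_sub, hgb.2]
          -- With `n = g * t ^ (-κ g)` in `H` and `b'` the conjugate of `Θ b` by `t ^ κ g`, the
          -- image of `(e g - 1) * b` is `(e n - 1) * b' + (b' - Θ b)`. Both summands gain weight.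
          have hc := conj_sub_mem_weightGE (t ^ κ g) hb2
          have hc' := add_mem (weightGE_anti H (Nat.le_succ w) hc) hb2
          have hn := mul_mem_weightGE (hκ g hg) (j := 0) (Subgroup.mem_top _) hc'
          have := add_mem hn hc
          convert this using 1
          rw [sub_add_cancel, ← zpow_neg]
          have i : e g = e (g * t ^ (-κ g)) * e (t ^ κ g) := by
            rw [← map_mul, zpow_neg, inv_mul_cancel_right]
          rw [i]
          noncomm_ring
      | zero => simp
      | add x y _ _ ihx ihy => rw [add_mul]; exact add_mem ihx ihy
      | smul q x _ ih => rw [smul_mul_assoc]; exact Submodule.smul_mem _ _ ih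
    exact hle ha

/-- If no nontrivial `z ∈ H` satisfies `z - 1 ∈ (aug H) ^ m`, the same is true for an extension of
`H` by an infinite cyclic group, with a larger exponent. -/
lemma exists_forall_notMem_aug_pow [H.Normal] {c : ℕ} (hc : 0 < c)
    (hG : (⊤ : Subgroup G).lowerCentralSeries c = ⊥)
    (hκ : ∀ g ∈ H', g * t ^ (-κ g) ∈ H)
    (hmul : ∀ g ∈ H', ∀ h ∈ H', κ (g * h) = κ g + κ h) {m : ℕ} (hm : 0 < m)
    (h : ∀ z ∈ H, z ≠ 1 → e z - 1 ∉ aug H ^ m) :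
    ∃ m', 0 < m' ∧ ∀ z ∈ H', z ≠ 1 → e z - 1 ∉ aug H' ^ m' := by
  -- The summand `2` places the power inside `aug H' ^ 2`, on which the linear extension of the
  -- additive `κ` vanishes, so that `κ z = 0` and `z ∈ H`. The summand `m * c` is the weight that
  -- forces membership in `aug H ^ m`.
  refine ⟨m * c + 2, by omega, fun z hz hz1 hmem => ?_⟩
  have hκ1 : κ 1 = 0 := by simpa using hmul 1 (one_mem _) 1 (one_mem _)
  have hκz : κ z = 0 := by
    let K : MonoidAlgebra ℚ G →ₗ[ℚ] ℚ := extend fun g => (κ g : ℚ)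
    have hK : ∀ g, K (e g) = κ g := extend_e _
    have h2 : aug H' ^ 2 ≤ LinearMap.ker K := by
      rw [pow_two, aug, Submodule.span_mul_span, Submodule.span_le]
      rintro _ ⟨_, ⟨g, hg, rfl⟩, _, ⟨h, hh, rfl⟩, rfl⟩
      have : (e g - 1) * (e h - 1) = e (g * h) - e g - e h + e 1 := by
        rw [map_mul, map_one]; noncomm_ring
      change K ((e g - 1) * (e h - 1)) = 0
      rw [this, map_add, map_sub, map_sub, hK, hK, hK, hK, hmul g hg h hh, hκ1]
      push_cast
      ring
    have := h2 (aug_pow_le_aug_pow H' (by omega) (by omega) hmem)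
    rw [LinearMap.mem_ker, map_sub, ← map_one e, hK, hK, hκ1] at this
    simpa using this
  have hzH : z ∈ H := by simpa [hκz] using hκ z hz
  have hΘ := (extend_mem_weightGE hκ hmul _ hmem).2
  rw [map_sub, ← map_one e, extend_e, extend_e, hκz, hκ1, neg_zero, zpow_zero, mul_one, mul_one,
    map_one] at hΘ
  exact h z hzH hz1 (weightGE_le_aug_pow H hc hG hm (weightGE_anti H (by omega) hΘ))

end Extension

/-- In a finitely generated torsion-free nilpotent group some power of the augmentation ideal of the
rational group algebra contains no `z - 1` with `z ≠ 1`. -/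
theorem exists_forall_notMem_aug_top_pow [Group.FG G] [Group.IsNilpotent G]
    (htf : ∀ g : G, IsOfFinOrder g → g = 1) :
    ∃ m, 0 < m ∧ ∀ z : G, z ≠ 1 → e z - 1 ∉ aug (⊤ : Subgroup G) ^ m := by
  have := Subgroup.wellFoundedGT_of_isNilpotent (G := G)
  obtain ⟨c, hc⟩ := Subgroup.nilpotent_iff_lowerCentralSeries.1 ‹Group.IsNilpotent G›
  have hc' : (⊤ : Subgroup G).lowerCentralSeries (c + 1) = ⊥ :=
    le_bot_iff.1 (hc ▸ Subgroup.lowerCentralSeries_antitone _ (Nat.le_succ c))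
  -- Isolation of `H` makes `G ⧸ H` torsion-free. If a maximal `H` were proper, the preimage of an
  -- isolated central infinite cyclic subgroup of `G ⧸ H` would be a larger member.
  let 𝒮 : Set (Subgroup G) := {H | H.Normal ∧ (∀ g : G, ∀ n : ℕ, 0 < n → g ^ n ∈ H → g ∈ H) ∧
    ∃ m, 0 < m ∧ ∀ z ∈ H, z ≠ 1 → e z - 1 ∉ aug H ^ m}
  have hbot : ⊥ ∈ 𝒮 := by
    refine ⟨inferInstance, fun g n hn hg => ?_, 1, one_pos, fun z hz hz1 => absurd hz hz1⟩
    exact htf g (isOfFinOrder_iff_pow_eq_one.2 ⟨n, hn, hg⟩)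
  obtain ⟨H, ⟨hH, hiso, m, hm, hHm⟩, hmax⟩ := wellFounded_gt.has_min 𝒮 ⟨⊥, hbot⟩
  rcases eq_or_ne H ⊤ with rfl | hne
  · exact ⟨m, hm, fun z hz => hHm z (Subgroup.mem_top z) hz⟩
  exfalso
  have := Subgroup.wellFoundedGT_quotient H
  have : Nontrivial (G ⧸ H) := QuotientGroup.nontrivial_iff.2 hne
  have htfQ : ∀ q : G ⧸ H, IsOfFinOrder q → q = 1 := by
    intro q hq
    obtain ⟨n, hn, hq⟩ := isOfFinOrder_iff_pow_eq_one.1 hq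
    obtain ⟨g, rfl⟩ := QuotientGroup.mk_surjective q
    rw [← QuotientGroup.mk_pow, QuotientGroup.eq_one_iff] at hq
    exact (QuotientGroup.eq_one_iff g).2 (hiso g n hn hq)
  obtain ⟨t, htc, ht1, htiso⟩ := Subgroup.exists_isolated_central htfQ
  obtain ⟨t, rfl⟩ := QuotientGroup.mk_surjective t
  have hzn : (Subgroup.zpowers (t : G ⧸ H)).Normal := by
    refine ⟨fun n hn g => ?_⟩
    have := Subgroup.mem_center_iff.1 ((Subgroup.zpowers_le.2 htc) hn) g
    rwa [this, mul_inv_cancel_right]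
  let H' := (Subgroup.zpowers (t : G ⧸ H)).comap (QuotientGroup.mk' H)
  have hinj : Function.Injective fun n : ℤ => (t : G ⧸ H) ^ n :=
    injective_zpow_iff_not_isOfFinOrder.2 fun h => ht1 (htfQ _ h)
  have hex : ∀ g : G, ∃ k : ℤ, g ∈ H' → (t : G ⧸ H) ^ k = g := by
    intro g
    by_cases hg : g ∈ H'
    · obtain ⟨k, hk⟩ := hg
      exact ⟨k, fun _ => hk⟩
    · exact ⟨0, fun h => absurd h hg⟩
  choose κ hκ using hex
  have hlt : H < H' := by
    refine lt_of_le_of_ne (fun h hh => ?_) fun heq => ?_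
    · change (h : G ⧸ H) ∈ Subgroup.zpowers (t : G ⧸ H)
      rw [(QuotientGroup.eq_one_iff h).2 hh]
      exact one_mem _
    · have : t ∈ H' := Subgroup.mem_zpowers (t : G ⧸ H)
      rw [← heq] at this
      exact ht1 ((QuotientGroup.eq_one_iff t).2 this)
  refine hmax H' ⟨hzn.comap _, fun g n hn hg => ?_, ?_⟩ hlt
  · refine htiso (g : G ⧸ H) n hn ?_
    have : (QuotientGroup.mk' H) (g ^ n) ∈ Subgroup.zpowers (t : G ⧸ H) := hg
    rwa [map_pow] at this
  · refine exists_forall_notMem_aug_pow (κ := κ) (t := t) c.succ_pos hc' ?_ ?_ hm hHm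
    · intro g hg
      rw [← QuotientGroup.eq_one_iff, QuotientGroup.mk_mul, QuotientGroup.mk_zpow, ← hκ g hg,
        ← zpow_add, add_neg_cancel, zpow_zero]
    · intro g hg h hh
      refine hinj ?_
      change (t : G ⧸ H) ^ _ = (t : G ⧸ H) ^ _
      rw [hκ _ (mul_mem hg hh), zpow_add, hκ g hg, hκ h hh, QuotientGroup.mk_mul]

end GroupAlgebra

/-! ### Faithful triangular representations -/

/-- The operators shift a finite filtration, so for `U ≠ 0` their images span a proper subspace of
`U`. A hyperplane `W` of `U` containing that subspace is invariant; a vector outside `W` is appended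
to a triangular basis of `W`. -/
lemma Submodule.exists_linearIndependent_triangular {K V ι : Type*} [Field K] [AddCommGroup V]
    [Module K V] [FiniteDimensional K V] (T : ι → V →ₗ[K] V) (F : ℕ → Submodule K V)
    (h0 : F 0 = ⊤) {m : ℕ} (hm : F m = ⊥) (hT : ∀ i k, ∀ v ∈ F k, T i v ∈ F (k + 1))
    (U : Submodule K V) (hU : ∀ i, ∀ v ∈ U, T i v ∈ U) :
    ∃ (n : ℕ) (b : Fin n → V), LinearIndependent K b ∧ span K (Set.range b) = U ∧
      ∀ i j, T i (b j) ∈ span K (b '' Set.Iio j) := by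
  induction U using WellFoundedLT.induction with
  | _ U ih =>
    rcases eq_or_ne U ⊥ with rfl | hne
    · exact ⟨0, Fin.elim0, linearIndependent_empty_type, by simp, fun _ j => j.elim0⟩
    let U₁ : Submodule K V := ⨆ i, U.map (T i)
    have hU₁ : U₁ ≤ U := iSup_le fun i => map_le_iff_le_comap.2 (hU i)
    have hlt : U₁ < U := by
      refine lt_of_le_of_ne hU₁ fun heq => hne ?_
      have hF : ∀ k, U ≤ F k := by
        intro k
        induction k with
        | zero => rw [h0]; exact le_top
        | succ k ihk =>
          rw [← heq]
          exact iSup_le fun i => map_le_iff_le_comap.2 fun v hv => hT i k v (ihk hv)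
      exact le_bot_iff.1 (hm ▸ hF m)
    obtain ⟨W, hW₁, hW⟩ := exists_le_covBy_of_lt hlt
    have hTW : ∀ i, ∀ v ∈ U, T i v ∈ W := fun i v hv =>
      hW₁ (mem_iSup_of_mem i (mem_map_of_mem hv))
    obtain ⟨n, b, hb, hspan, htri⟩ := ih W hW.lt fun i v hv => hTW i v (hW.le hv)
    obtain ⟨y, hyU, hyW⟩ := SetLike.exists_of_lt hW.lt
    refine ⟨n + 1, Fin.snoc b y, linearIndependent_finSnoc.2 ⟨hb, hspan ▸ hyW⟩, ?_, ?_⟩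
    · rw [Fin.range_snoc, span_insert, hspan]
      refine (hW.eq_or_eq le_sup_right (sup_le ((span_singleton_le_iff_mem _ _).2 hyU)
        hW.le)).resolve_left fun h => hyW ?_
      rw [← h]
      exact mem_sup_left (mem_span_singleton_self y)
    · intro i j
      induction j using Fin.lastCases with
      | last =>
        rw [Fin.snoc_last]
        refine span_mono ?_ (hspan ▸ hTW i y hyU)
        rintro _ ⟨k, rfl⟩
        exact ⟨k.castSucc, Fin.castSucc_lt_last k, by simp⟩
      | cast j =>
        rw [Fin.snoc_castSucc]
        refine span_mono ?_ (htri i j)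
        rintro _ ⟨k, hk, rfl⟩
        exact ⟨k.castSucc, Fin.castSucc_lt_castSucc_iff.2 hk, by simp⟩

lemma Module.Basis.exists_triangular {K V ι : Type*} [Field K] [AddCommGroup V]
    [Module K V] [FiniteDimensional K V] (T : ι → V →ₗ[K] V) (F : ℕ → Submodule K V)
    (h0 : F 0 = ⊤) {m : ℕ} (hm : F m = ⊥) (hT : ∀ i k, ∀ v ∈ F k, T i v ∈ F (k + 1)) :
    ∃ (n : ℕ) (b : Module.Basis (Fin n) K V), ∀ i j k, j ≤ k → b.repr (T i (b j)) k = 0 := by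
  obtain ⟨n, b, hb, hspan, htri⟩ :=
    Submodule.exists_linearIndependent_triangular T F h0 hm hT ⊤ fun _ _ _ => trivial
  refine ⟨n, .mk hb hspan.ge, fun i j k hjk => ?_⟩
  have h := htri i j
  rw [← Module.Basis.coe_mk hb hspan.ge, Module.Basis.mem_span_image] at h
  by_contra hne
  exact (not_lt.2 hjk) (h (Finsupp.mem_support_iff.2 hne))

/-! ### The action on the group algebra modulo a power of the augmentation ideal -/

namespace GroupAlgebra

variable {G : Type*} [Group G]

lemma e_sub_one_mul_mem_aug (g : G) (a : MonoidAlgebra ℚ G) :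
    (e g - 1) * a ∈ aug (⊤ : Subgroup G) := by
  have ha : a ∈ Submodule.span ℚ (Set.range (MonoidAlgebra.basis G ℚ)) := by
    rw [Module.Basis.span_eq]; trivial
  induction ha using Submodule.span_induction with
  | mem a ha =>
    obtain ⟨h, rfl⟩ := ha
    have : (e g - 1) * e h = (e (g * h) - 1) - (e h - 1) := by rw [map_mul]; noncomm_ring
    rw [MonoidAlgebra.basis_apply]
    change (e g - 1) * e h ∈ _
    rw [this]
    exact sub_mem (sub_one_mem_aug trivial) (sub_one_mem_aug trivial)
  | zero => simp
  | add a b _ _ iha ihb => rw [mul_add]; exact add_mem iha ihb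
  | smul c a _ ih => rw [mul_smul_comm]; exact Submodule.smul_mem _ _ ih

/-- Modulo the square of the augmentation ideal, `g ↦ e g - 1` turns products into sums, so the
generators of `G` suffice. -/
lemma aug_le_sup [hG : Group.FG G] : ∃ X : Submodule ℚ (MonoidAlgebra ℚ G), X.FG ∧
    X ≤ aug (⊤ : Subgroup G) ∧ aug (⊤ : Subgroup G) ≤ X ⊔ aug (⊤ : Subgroup G) ^ 2 := by
  obtain ⟨S, hS⟩ := Group.fg_def.1 hG
  let X : Submodule ℚ (MonoidAlgebra ℚ G) := Submodule.span ℚ ((fun s => e s - 1) '' (S : Set G))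
  refine ⟨X, Submodule.fg_span (S.finite_toSet.image _), ?_, ?_⟩
  · exact Submodule.span_mono (Set.image_mono (Set.subset_univ _))
  refine Submodule.span_le.2 ?_
  rintro _ ⟨g, -, rfl⟩
  change e g - 1 ∈ X ⊔ aug (⊤ : Subgroup G) ^ 2
  have h2 : ∀ g h : G, (e g - 1) * (e h - 1) ∈ X ⊔ aug (⊤ : Subgroup G) ^ 2 := fun g h => by
    refine Submodule.mem_sup_right ?_
    rw [pow_two]
    exact Submodule.mul_mem_mul (sub_one_mem_aug trivial) (sub_one_mem_aug trivial)
  have hg : g ∈ Subgroup.closure (S : Set G) := hS ▸ Subgroup.mem_top g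
  induction hg using Subgroup.closure_induction with
  | mem s hs => exact Submodule.mem_sup_left (Submodule.subset_span ⟨s, hs, rfl⟩)
  | one => rw [map_one, sub_self]; exact zero_mem _
  | mul g h _ _ ihg ihh =>
    have : e (g * h) - 1 = (e g - 1) + (e h - 1) + (e g - 1) * (e h - 1) := by
      rw [map_mul]; noncomm_ring
    rw [this]
    exact add_mem (add_mem ihg ihh) (h2 g h)
  | inv g _ ih =>
    have h1 : e g⁻¹ * e g = 1 := by rw [← map_mul, inv_mul_cancel, map_one]
    have : e g⁻¹ - 1 = -(e g - 1) - (e g⁻¹ - 1) * (e g - 1) := by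
      rw [sub_mul, mul_sub, h1]; noncomm_ring
    rw [this]
    exact sub_mem (neg_mem ih) (h2 _ _)

/-- Each quotient `I ^ k / I ^ (k + 1)` is spanned by the `k`-fold products from the
finite-dimensional `X`, so `I ^ m` has finite codimension. -/
lemma exists_fg_sup_aug_pow_eq_top [Group.FG G] {m : ℕ} (hm : 0 < m) :
    ∃ W : Submodule ℚ (MonoidAlgebra ℚ G), W.FG ∧ W ⊔ aug (⊤ : Subgroup G) ^ m = ⊤ := by
  obtain ⟨X, hX, hXle, hle⟩ := aug_le_sup (G := G)
  set I := aug (⊤ : Subgroup G)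
  have hpow : ∀ k, I ^ k ≤ X ^ k ⊔ I ^ (k + 1) := by
    intro k
    induction k with
    | zero => rw [pow_zero, pow_zero]; exact le_sup_left
    | succ k ih =>
      calc I ^ (k + 1) = I ^ k * I := pow_succ _ _
        _ ≤ (X ^ k ⊔ I ^ (k + 1)) * I := mul_le_mul_left ih _
        _ = X ^ k * I ⊔ I ^ (k + 2) := by rw [Submodule.sup_mul, ← pow_succ]
        _ ≤ (X ^ (k + 1) ⊔ I ^ (k + 2)) ⊔ I ^ (k + 2) := by
            refine sup_le_sup_right ?_ _
            calc X ^ k * I ≤ X ^ k * (X ⊔ I ^ 2) := mul_le_mul_right hle _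
              _ = X ^ (k + 1) ⊔ X ^ k * I ^ 2 := by rw [Submodule.mul_sup, ← pow_succ]
              _ ≤ X ^ (k + 1) ⊔ I ^ (k + 2) := by
                  refine sup_le_sup_left ?_ _
                  rw [pow_add]
                  exact mul_le_mul_left (pow_le_pow_left' hXle k) _
        _ = X ^ (k + 1) ⊔ I ^ (k + 1 + 1) := by rw [sup_assoc, sup_idem]
  induction m, hm using Nat.le_induction with
  | base =>
    refine ⟨Submodule.span ℚ {1}, Submodule.fg_span_singleton 1, eq_top_iff.2 ?_⟩
    rw [← (MonoidAlgebra.basis G ℚ).span_eq, Submodule.span_le]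
    rintro _ ⟨g, rfl⟩
    have : e g ∈ Submodule.span ℚ {1} ⊔ I ^ (0 + 1) := by
      rw [← add_sub_cancel 1 (e g), zero_add, pow_one]
      exact Submodule.add_mem_sup (Submodule.mem_span_singleton_self 1) (sub_one_mem_aug trivial)
    rwa [MonoidAlgebra.basis_apply]
  | succ m _ ih =>
    obtain ⟨W, hW, hWtop⟩ := ih
    refine ⟨W ⊔ X ^ m, hW.sup (hX.pow m), eq_top_iff.2 ?_⟩
    rw [← hWtop, sup_assoc]
    exact sup_le_sup_left (hpow m) W

/-- A finitely generated torsion-free nilpotent group has a faithful rational unitriangular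
representation. -/
theorem exists_injective_unitriangular [Group.FG G] [Group.IsNilpotent G]
    (htf : ∀ g : G, IsOfFinOrder g → g = 1) :
    ∃ (d : ℕ) (φ : G →* upperTriangular d ℚ), Function.Injective φ ∧
      ∀ g i, (φ g).1 i i = 1 := by
  obtain ⟨m, hm, hinj⟩ := exists_forall_notMem_aug_top_pow htf
  obtain ⟨W, hW, hWtop⟩ := exists_fg_sup_aug_pow_eq_top (G := G) hm
  set I := aug (⊤ : Subgroup G)
  have hstep : ∀ k, ∀ g : G, ∀ a ∈ I ^ k, (e g - 1) * a ∈ I ^ (k + 1) := fun k g a ha => by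
    rw [pow_succ']
    exact Submodule.mul_mem_mul (sub_one_mem_aug trivial) ha
  have hI : ∀ g : G, I ^ m ≤ (I ^ m).comap (LinearMap.mulLeft ℚ (e g)) := by
    intro g a ha
    have := add_mem (aug_pow_le_aug_pow _ hm (Nat.le_succ m) (hstep m g a ha)) ha
    rwa [sub_mul, one_mul, sub_add_cancel] at this
  let V := MonoidAlgebra ℚ G ⧸ I ^ m
  have hV : FiniteDimensional ℚ V := by
    refine Module.finite_def.2 ?_
    have : W.map (I ^ m).mkQ = ⊤ := by
      rw [← (I ^ m).range_mkQ, ← Submodule.map_top, ← hWtop, Submodule.map_sup]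
      simp
    rw [← this]
    exact hW.map _
  let ρ : G →* Module.End ℚ V :=
    { toFun := fun g => (I ^ m).mapQ (I ^ m) (LinearMap.mulLeft ℚ (e g)) (hI g)
      map_one' := by
        ext a
        simp
      map_mul' := fun g h => by
        refine Submodule.linearMap_qext _ (LinearMap.ext fun a => ?_)
        change (I ^ m).mkQ (e (g * h) * a) = (I ^ m).mkQ (e g * (e h * a))
        rw [map_mul e, mul_assoc] }
  -- The filtration must begin with the whole algebra, whereas `I ^ 0` is only the scalars.
  let J : ℕ → Submodule ℚ (MonoidAlgebra ℚ G) := fun k => if k = 0 then ⊤ else I ^ k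
  let F : ℕ → Submodule ℚ V := fun k => (J k).map (I ^ m).mkQ
  obtain ⟨d, b, hb⟩ := Module.Basis.exists_triangular (fun g => ρ g - 1) F (m := m)
    (by simp only [F, J, if_true, Submodule.map_top]; exact Submodule.range_mkQ _)
    (by simp only [F, J, hm.ne', if_false]; exact Submodule.mkQ_map_self _) (by
      rintro g k _ ⟨a, ha, rfl⟩
      refine ⟨(e g - 1) * a, ?_, ?_⟩
      · rcases Nat.eq_zero_or_pos k with rfl | hk
        · simpa [J] using e_sub_one_mul_mem_aug g a
        · simp only [J, hk.ne', if_false, SetLike.mem_coe] at ha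
          simpa [J] using hstep k g a ha
      · rw [sub_mul, one_mul, map_sub]
        rfl)
  let M := LinearMap.toMatrixAlgEquiv b
  have hM : ∀ g i j, M (ρ g) i j = (if i = j then 1 else 0) + b.repr ((ρ g - 1) (b j)) i := by
    intro g i j
    rw [LinearMap.sub_apply, Module.End.one_apply, map_sub, Finsupp.sub_apply,
      Module.Basis.repr_self, Finsupp.single_apply]
    simp only [M, LinearMap.toMatrixAlgEquiv_apply, eq_comm (a := i)]
    ring
  have htri : ∀ g, M (ρ g) ∈ upperTriangular d ℚ := by
    intro g i j hij
    have hij' : j < i := hij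
    rw [hM, if_neg hij'.ne', hb g j i hij'.le, add_zero]
  refine ⟨d, ((M : _ →* _).comp ρ).codRestrict _ htri, ?_, fun g i => ?_⟩
  · refine (injective_iff_map_eq_one _).2 fun g hg => ?_
    have h1 : M (ρ g) = 1 := congrArg Subtype.val hg
    have h2 : ρ g = 1 := M.injective (h1.trans (map_one M).symm)
    by_contra hne
    refine hinj g hne ?_
    -- Evaluated at the class of `1`, triviality of `ρ g` says that `e g - 1` lies in `I ^ m`.
    have h3 := congrArg (fun f => f ((I ^ m).mkQ 1)) h2
    change (I ^ m).mkQ (e g * 1) = (I ^ m).mkQ 1 at h3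
    rw [mul_one] at h3
    exact (Submodule.Quotient.eq _).1 h3
  · change M (ρ g) i i = 1
    rw [hM, if_pos rfl, hb g i i le_rfl, add_zero]

open upperTriangular in
/-- A finitely generated torsion-free nilpotent group embeds into a group of integral upper
triangular matrices. -/
theorem exists_injective_upperTriangular_int [hG : Group.FG G] [Group.IsNilpotent G]
    (htf : ∀ g : G, IsOfFinOrder g → g = 1) :
    ∃ (d : ℕ) (φ : G →* (upperTriangular d ℤ)ˣ), Function.Injective φ := by
  obtain ⟨d, φ, hφ, hdiag⟩ := exists_injective_unitriangular htf
  obtain ⟨S, hS⟩ := Group.fg_def.1 hG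
  -- `D` is a common denominator for the generators and their inverses. Dilation by `D` multiplies
  -- each entry above the diagonal by a positive power of `D`, and the diagonal is `1`, so these
  -- matrices become integral, and with them the whole image.
  obtain ⟨⟨D, hD⟩, hden⟩ := IsLocalization.exist_integer_multiples_of_finite (nonZeroDivisors ℤ)
    (S := ℚ) fun p : (S × Bool) × Fin d × Fin d =>
      (φ (cond p.1.2 p.1.1.1 p.1.1.1⁻¹)).1 p.2.1 p.2.2
  have hD0 : (D : ℚ) ≠ 0 := by exact_mod_cast nonZeroDivisors.ne_zero hD
  let ι : upperTriangular d ℤ →* upperTriangular d ℚ :=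
    (((Int.castRingHom ℚ).mapMatrix.toMonoidHom : Matrix (Fin d) (Fin d) ℤ →* _).comp
      (upperTriangular d ℤ).subtype).codRestrict _ fun A i j hij => by
        change ((A.1 i j : ℤ) : ℚ) = 0
        rw [A.2 hij, Int.cast_zero]
  have hι : ∀ A i j, (ι A).1 i j = ((A.1 i j : ℤ) : ℚ) := fun _ _ _ => rfl
  have hιinj : Function.Injective ι := by
    intro A B h
    ext i j
    have := congrArg (fun M : upperTriangular d ℚ => M.1 i j) h
    simpa [hι] using this
  have hlift : ∀ A : upperTriangular d ℚ, (∀ i j, ∃ z : ℤ, A.1 i j = z) → A ∈ MonoidHom.mrange ι := by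
    intro A h
    choose z hz using h
    have hz' : (Matrix.of z).IsUpperTriangular := fun i j hij => by
      have := hz i j
      rw [A.2 hij] at this
      exact_mod_cast this.symm
    refine ⟨⟨_, hz'⟩, ?_⟩
    ext i j
    rw [hι, hz]
    rfl
  let ψ : G →* upperTriangular d ℚ := (dilation d (D : ℚ)).comp φ
  have hψ : ∀ g, ψ g ∈ MonoidHom.mrange ι := by
    have hgen : ∀ s ∈ S, ∀ c : Bool, ψ (cond c s s⁻¹) ∈ MonoidHom.mrange ι := by
      intro s hs c
      refine hlift _ fun i j => ?_
      change ∃ z : ℤ, (D : ℚ) ^ ((j : ℕ) - i) * (φ (cond c s s⁻¹)).1 i j = z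
      rcases lt_trichotomy i j with hij | rfl | hij
      · obtain ⟨z, hz⟩ := hden ((⟨s, hs⟩, c), i, j)
        refine ⟨D ^ ((j : ℕ) - i - 1) * z, ?_⟩
        have hz' : (z : ℚ) = (D : ℚ) * (φ (cond c s s⁻¹)).1 i j := by
          simpa [Algebra.smul_def] using hz
        rw [Int.cast_mul, hz', Int.cast_pow, ← mul_assoc, ← pow_succ]
        congr 2
        rw [Fin.lt_def] at hij
        omega
      · exact ⟨1, by simp [hdiag]⟩
      · exact ⟨0, by rw [(φ _).2 hij, mul_zero, Int.cast_zero]⟩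
    intro g
    have hg : g ∈ Subgroup.closure (S : Set G) := hS ▸ Subgroup.mem_top g
    induction hg using Subgroup.closure_induction'' with
    | one => rw [map_one]; exact one_mem _
    | mem s hs => exact hgen s hs true
    | inv_mem s hs => exact hgen s hs false
    | mul g h _ _ ihg ihh => rw [map_mul]; exact mul_mem ihg ihh
  choose θ hθ using hψ
  let θ' : G →* upperTriangular d ℤ :=
    { toFun := θ
      map_one' := hιinj (by rw [hθ, map_one, map_one])
      map_mul' := fun g h => hιinj (by rw [hθ, map_mul, map_mul, hθ, hθ]) }
  refine ⟨d, θ'.toHomUnits, fun g h hgh => hφ (dilation_injective hD0 ?_)⟩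
  have h1 : θ g = θ h := congrArg Units.val hgh
  change ψ g = ψ h
  rw [← hθ, ← hθ, h1]

end GroupAlgebra

/-! ### The word problems -/

theorem wordProblemLinearTime_of_torsionFree_nilpotent {G : Type*} [Group G] [Group.FG G]
    [Group.IsNilpotent G] (htf : ∀ g : G, IsOfFinOrder g → g = 1) {S : Set G} (hS : S.Finite) :
    WordProblemLinearTime S := by
  obtain ⟨d, φ, hφ⟩ := GroupAlgebra.exists_injective_upperTriangular_int htf
  refine wordProblemLinearTime_of_upperTriangular hS (fun a => φ a) fun w => ?_
  rw [← map_eq_one_iff φ hφ, wordValue, map_list_prod, List.map_map]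
  rfl

open upperTriangular Matrix in
/-- The case of integral matrices that become upper triangular after a permutation of the basis that
preserves distances. -/
theorem wordProblem_of_submatrix_isUpperTriangular {d : ℕ} {S : Set (GL (Fin d) ℤ)}
    (hS : S.Finite) (σ : Equiv.Perm (Fin d))
    (hσ : ∀ i j, ((σ j : ℤ) - (σ i : ℤ)).natAbs = ((j : ℤ) - (i : ℤ)).natAbs)
    (htri : ∀ A ∈ S, ((A : Matrix (Fin d) (Fin d) ℤ).submatrix σ σ).IsUpperTriangular) :
    WordProblemLinearTime S ∧
      ∃ C : ℕ, ∀ (w : List (symAlphabet S)) (i j : Fin d),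
        |((wordValue w : GL (Fin d) ℤ) : Matrix (Fin d) (Fin d) ℤ) i j| ≤
          (C : ℤ) * ((w.length : ℤ) + 1) ^ ((j : ℤ) - (i : ℤ)).natAbs := by
  let ψ : GL (Fin d) ℤ →* Matrix (Fin d) (Fin d) ℤ :=
    ((reindexAlgEquiv ℤ ℤ σ.symm : Matrix (Fin d) (Fin d) ℤ ≃ₐ[ℤ] Matrix (Fin d) (Fin d) ℤ) :
      Matrix (Fin d) (Fin d) ℤ →* Matrix (Fin d) (Fin d) ℤ).comp (Units.coeHom _)
  have hψ : ∀ A i j, ψ A i j = A.1 (σ i) (σ j) := fun _ _ _ => rfl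
  have hinj : Function.Injective ψ := by
    intro A B h
    ext i j
    have := congrArg (fun M : Matrix (Fin d) (Fin d) ℤ => M (σ.symm i) (σ.symm j)) h
    simpa [hψ] using this
  have hinv : ∀ A : GL (Fin d) ℤ, (ψ A).IsUpperTriangular → (ψ A⁻¹).IsUpperTriangular := by
    intro A hA
    let _ : Invertible (ψ A) := ⟨ψ A⁻¹, by rw [← map_mul, inv_mul_cancel, map_one],
      by rw [← map_mul, mul_inv_cancel, map_one]⟩
    have := blockTriangular_inv_of_blockTriangular hA
    rwa [← invOf_eq_nonsing_inv] at this
  have hletter : ∀ a : symAlphabet S,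
      (ψ a).IsUpperTriangular ∧ (ψ (a : GL (Fin d) ℤ)⁻¹).IsUpperTriangular := by
    rintro ⟨a, ha | ha⟩
    · exact ⟨htri a ha, hinv a (htri a ha)⟩
    · exact ⟨by simpa using hinv a⁻¹ (htri _ ha), htri _ ha⟩
  let φ : symAlphabet S → (upperTriangular d ℤ)ˣ := fun a =>
    ⟨⟨ψ a, (hletter a).1⟩, ⟨ψ (a : GL (Fin d) ℤ)⁻¹, (hletter a).2⟩,
      Subtype.ext (by
        change ψ a * ψ (a : GL (Fin d) ℤ)⁻¹ = 1
        rw [← map_mul, mul_inv_cancel, map_one]),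
      Subtype.ext (by
        change ψ (a : GL (Fin d) ℤ)⁻¹ * ψ a = 1
        rw [← map_mul, inv_mul_cancel, map_one])⟩
  have hprod : ∀ w : List (symAlphabet S), (w.map φ).prod.1.1 = ψ (wordValue w) := by
    intro w
    induction w with
    | nil => exact (map_one ψ).symm
    | cons a w ih =>
      have h : wordValue (a :: w) = a * wordValue w := rfl
      rw [h, map_mul, ← ih, List.map_cons, List.prod_cons]
      rfl
  refine ⟨wordProblemLinearTime_of_upperTriangular hS φ fun w => ?_, ?_⟩
  · rw [← map_eq_one_iff ψ hinj, ← hprod, ← Units.val_eq_one]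
    exact ⟨fun h => Subtype.ext h, fun h => congrArg Subtype.val h⟩
  · have := symAlphabet_finite hS
    obtain ⟨s, hs⟩ := exists_sizeLE_finite φ
    -- Subadditivity bounds an entry by `(|w| * s) ^ k` with `k = j - i ≤ d`; the factor `s ^ k` is
    -- absorbed in `(s + 1) ^ d`.
    refine ⟨(s + 1) ^ d, fun w i j => ?_⟩
    have hsize := sizeLE_prod (s := s) (w.map φ) fun A hA => by
      obtain ⟨a, -, rfl⟩ := List.mem_map.1 hA
      exact hs a
    obtain ⟨i, rfl⟩ := σ.surjective i
    obtain ⟨j, rfl⟩ := σ.surjective j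
    rw [hσ, ← hψ, ← hprod]
    rcases lt_or_ge j i with hij | hij
    · rw [(w.map φ).prod.1.2 hij, abs_zero]
      positivity
    · refine (abs_le_of_sizeLE hsize hij).trans ?_
      have hk : ((j : ℤ) - (i : ℤ)).natAbs = (j : ℕ) - i := by
        have : (i : ℕ) ≤ j := hij
        omega
      have hkd : (j : ℕ) - i ≤ d := by omega
      rw [hk, List.length_map, Nat.cast_mul, mul_pow, mul_comm, Nat.cast_pow, Nat.cast_add,
        Nat.cast_one]
      have h1 : (s : ℤ) ^ ((j : ℕ) - i) ≤ ((s : ℤ) + 1) ^ d :=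
        (pow_le_pow_left₀ (by positivity) (by omega) _).trans (pow_le_pow_right₀ (by omega) hkd)
      have h2 : (w.length : ℤ) ^ ((j : ℕ) - i) ≤ ((w.length : ℤ) + 1) ^ ((j : ℕ) - i) :=
        pow_le_pow_left₀ (by positivity) (by omega) _
      exact mul_le_mul h1 h2 (by positivity) (by positivity)

theorem mainTheorem4 :
    (∀ (d : ℕ) (S : Set (Matrix.GeneralLinearGroup (Fin d) ℤ)), S.Finite →
      ((∀ A ∈ S, (A : Matrix (Fin d) (Fin d) ℤ).IsUpperTriangular) ∨
        (∀ A ∈ S, (A : Matrix (Fin d) (Fin d) ℤ).IsLowerTriangular)) →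
      WordProblemLinearTime S ∧
      ∃ C : ℕ, ∀ (w : List (symAlphabet S)) (i j : Fin d),
        |((wordValue w : Matrix.GeneralLinearGroup (Fin d) ℤ) : Matrix (Fin d) (Fin d) ℤ) i j| ≤
          (C : ℤ) * ((w.length : ℤ) + 1) ^ ((j : ℤ) - (i : ℤ)).natAbs) ∧
    (∀ (G : Type*) [Group G], Group.FG G → Group.IsNilpotent G →
      (∀ g : G, IsOfFinOrder g → g = 1) →
      ∀ S : Set G, S.Finite → WordProblemLinearTime S) := by
  refine ⟨fun d S hS htri => ?_, fun G _ _ _ htf S hS =>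
    wordProblemLinearTime_of_torsionFree_nilpotent htf hS⟩
  rcases htri with h | h
  · exact wordProblem_of_submatrix_isUpperTriangular hS 1 (fun _ _ => rfl) h
  -- Reversing the order of the basis turns lower triangular matrices into upper triangular ones and
  -- preserves `|j - i|`.
  · refine wordProblem_of_submatrix_isUpperTriangular hS Fin.revPerm (fun i j => ?_) ?_
    · simp only [Fin.revPerm_apply, Fin.val_rev]
      omega
    · intro A hA i j hij
      exact h A hA (show Fin.rev i < Fin.rev j from Fin.rev_lt_rev.2 hij)
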